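/- Theorem 5.8. Let $n\ge 1$ and $s,\alpha\in(0,\infty)$. For $f:\mathbb R^n\to\mathbb R$ let $\Delta_hf(x):=f(x+\tfrac h2)-f(x-\tfrac h2)$ and $\Delta_h^{k+1}:=\Delta_h^k\Delta_h$, and let $\Lambda_s$ be the space of all continuous $f:\mathbb R^n\to\mathbb R$ with $$\|f\|_{\Lambda_s}:=\|f\|_{L^\infty}+\sup_{0<y\le 1}\ \sup_{x\in\mathbb R^n}\ \sup_{|h|=y}\frac{|\Delta_h^{r}f(x)|}{y^s}<\infty,\qquad r:=\lfloor s\rfloor+1 .$$ For $t\in(0,\infty)$ let $$K_\alpha(x,t):=\int_{\mathbb R^n}e^{-t|2\pi\xi|^\alpha}e^{2\pi i x\cdot\xi}\,d\xi,\qquad T_{\alpha,t}f(x):=\int_{\mathbb R^n}K_\alpha(x-z,t)f(z)\,dz$$ be the fractional heat kernel and the fractional heat semigroup $T_{\alpha,t}=e^{-t(-\Delta)^{\alpha/2}}$, and let $u_\alpha(x,t):=T_{\alpha,t}f(x)$ for $x\in\mathbb R^n$, $t\in(0,\infty)$. Let $i\in\mathbb Z_+$ and $\beta\in\mathbb Z_+^n$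 with $|\beta|+i\alpha>s$. For every $f\in\Lambda_s$ the integrals defining $u_\alpha$ converge absolutely; for every $t>0$ one has $\mathcal F(T_{\alpha,t}f)=e^{-t|2\pi\cdot|^\alpha}\mathcal Ff$ in the sense that $\int T_{\alpha,t}f\cdot\mathcal F\psi\,dx=\int f\cdot\mathcal F(e^{-t|2\pi\cdot|^\alpha}\psi)\,dx$ for all Schwartz functions $\psi$, with both integrals absolutely convergent; and $u_\alpha$ is $C^\infty$ on $\mathbb R^n\times(0,\infty)$. Moreover, there is a constant $C\in(0,\infty)$, depending only on $n,\alpha,s,\beta$ and $i$, such that, for every $f\in\Lambda_s$, $$\sup_{t\in(0,\infty)}t^{\frac{|\beta|}{\alpha}+i-\frac s\alpha}\ \sup_{x\in\mathbb R^n}\bigl|\partial_t^i\partial_x^\beta u_\alpha(x,t)\bigr|\le C\,\|f\|_{\Lambda_s}.$$ -/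

import Mathlib

open MeasureTheory Set
open scoped ENNReal FourierTransform ContDiff

namespace FracHeat

noncomputable section

/-- The symmetric difference `Δ_h f (x) = f (x + h/2) - f (x - h/2)`; its `k`-th iterate
`(centralDiff h)^[k]` is the `k`-th order symmetric difference operator `Δ_h^k`. -/
def centralDiff {n : ℕ} (h : EuclideanSpace ℝ (Fin n)) (f : EuclideanSpace ℝ (Fin n) → ℝ) :
    EuclideanSpace ℝ (Fin n) → ℝ :=
  fun x => f (x + (1 / 2 : ℝ) • h) - f (x - (1 / 2 : ℝ) • h)

/-- `Δ_k f (x, y) = sup_{|h| = y} |Δ_h^k f (x)|`, as an extended nonnegative number. -/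
def diffSup {n : ℕ} (k : ℕ) (f : EuclideanSpace ℝ (Fin n) → ℝ) (x : EuclideanSpace ℝ (Fin n))
    (y : ℝ) : ℝ≥0∞ :=
  ⨆ (h : EuclideanSpace ℝ (Fin n)) (_ : ‖h‖ = y), ‖((centralDiff h)^[k] f) x‖ₑ

/-- The Lipschitz norm `‖f‖_{L^∞} + sup_{0 < y ≤ 1} sup_x Δ_r f (x, y) / y ^ s` with
`r = ⌊s⌋ + 1`, as an extended nonnegative number. -/
def lipNorm {n : ℕ} (s : ℝ) (f : EuclideanSpace ℝ (Fin n) → ℝ) : ℝ≥0∞ :=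
  eLpNorm f ⊤ volume +
    ⨆ (y : ℝ) (_ : y ∈ Ioc (0 : ℝ) 1) (x : EuclideanSpace ℝ (Fin n)),
      diffSup (⌊s⌋₊ + 1) f x y / ENNReal.ofReal (y ^ s)

/-- Membership in the Lipschitz space `Λ_s`. -/
def MemLip {n : ℕ} (s : ℝ) (f : EuclideanSpace ℝ (Fin n) → ℝ) : Prop :=
  Continuous f ∧ lipNorm s f < ⊤

/-- The symbol `ξ ↦ exp (-t |2πξ|^α)` of the operator `exp (-t (-Δ)^{α/2})`. -/
def heatSymbol {n : ℕ} (α t : ℝ) (ξ : EuclideanSpace ℝ (Fin n)) : ℂ :=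
  (Real.exp (-t * (2 * Real.pi * ‖ξ‖) ^ α) : ℝ)

/-- The fractional heat kernel
`K_α (x, t) = ∫ exp (-t |2πξ|^α) exp (2πi x·ξ) dξ`. -/
def heatKernel {n : ℕ} (α t : ℝ) (x : EuclideanSpace ℝ (Fin n)) : ℂ :=
  (𝓕⁻ (heatSymbol (n := n) α t)) x

/-- The fractional heat semigroup on bounded functions,
`T_{α,t} f (x) = ∫ K_α (x - z, t) f (z) dz`. -/
def heatSemigroup {n : ℕ} (α t : ℝ) (f : EuclideanSpace ℝ (Fin n) → ℝ)
    (x : EuclideanSpace ℝ (Fin n)) : ℂ :=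
  ∫ z, heatKernel α t (x - z) * (f z : ℂ)

/-- `𝓕 g = m · 𝓕 f` in the distributional sense, for a symbol `m` which need not be smooth: the
two sides agree on every Schwartz function `ψ`, where `⟨𝓕 g, ψ⟩ = ∫ g 𝓕ψ` and
`⟨m 𝓕 f, ψ⟩ = ∫ f 𝓕(m ψ)`, both integrals being absolutely convergent. -/
def IsMultiplierImage {n : ℕ} (m f g : EuclideanSpace ℝ (Fin n) → ℂ) : Prop :=
  ∀ ψ : SchwartzMap (EuclideanSpace ℝ (Fin n)) ℂ,
    Integrable (fun x => g x * (𝓕 (fun ξ => ψ ξ)) x) ∧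
    Integrable (fun x => f x * (𝓕 (fun ξ => m ξ * ψ ξ)) x) ∧
    ∫ x, g x * (𝓕 (fun ξ => ψ ξ)) x = ∫ x, f x * (𝓕 (fun ξ => m ξ * ψ ξ)) x

/-- The partial derivative `∂/∂x_j`. -/
def partialX {n : ℕ} (j : Fin n) (g : EuclideanSpace ℝ (Fin n) → ℂ) :
    EuclideanSpace ℝ (Fin n) → ℂ :=
  fun x => lineDeriv ℝ g x (EuclideanSpace.single j 1)

/-- The multi-index derivative `∂_x^β = (∂/∂x_1)^{β_1} ⋯ (∂/∂x_n)^{β_n}`. -/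
def multiDeriv {n : ℕ} (β : Fin n → ℕ) (g : EuclideanSpace ℝ (Fin n) → ℂ) :
    EuclideanSpace ℝ (Fin n) → ℂ :=
  (List.finRange n).foldr (fun j φ => (partialX j)^[β j] φ) g

/-- The mixed derivative `∂_t^i ∂_x^β u (x, t)`, where `u (x, t)` is written `u t x`. -/
def mixedDeriv {n : ℕ} (i : ℕ) (β : Fin n → ℕ) (u : ℝ → EuclideanSpace ℝ (Fin n) → ℂ)
    (t : ℝ) (x : EuclideanSpace ℝ (Fin n)) : ℂ :=
  iteratedDeriv i (fun τ => multiDeriv β (u τ) x) t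

end

end FracHeat

set_option linter.unusedSectionVars false

namespace FracHeat

/-! The symbol of `∂_t^i ∂_x^β e^{-t(-Δ)^{α/2}}` is, up to a constant, a homogeneous polynomial `p`
times a radial factor `φ(|ξ|^2)` with `φ(v) = v^c exp(-b v^a)`, `a = α/2`, `b = t(2π)^α`. It may be
singular at the origin, so its kernel is not a Schwartz function. The remedy is to expand `φ` at
infinity by Taylor's formula, `φ(x) = ∫ (v - x)_+^K w(v) dv` with `w = (-1)^{K+1} φ^{(K+1)} / K!`
(`integral_truncatedPow_mul_taylorWeight`). The kernel thereby becomes a superposition of dilates by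
`√v` of one fixed function, the inverse Fourier transform of the Bochner-Riesz symbol `p(ξ)(1 -
|ξ|^2)_+^K` (`fourierInv_radialSymbol_eq`). For `K = n + 2` that symbol is `C^{n+1}` with compact
support, so its transform decays like `|y|^{-(n+1)}`.

Integrating this decay against the density in `v` bounds every derivative of the kernel by `(1 +
|x|)^{-(n+θ)}` with some `θ > 0`, uniformly for `t` in compact subsets of `(0, ∞)`
(`exists_norm_mixedKernel_le`). Absolute convergence, the multiplier identity (Fubini) and
smoothness (differentiation under the integral sign, `isJetFamily_mixedHeat`) follow for every
bounded continuous `f`.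

For the derivative bound, `|ξ|^{2L}` is moved from the radial factor into `p`, where `L = nr + 1`.
By pigeonhole, `|ξ|^{2L}` lies in the ideal generated by the `ξ_j^{2(r+1)}`, and on the unit ball
`ξ_j^r` is a smooth multiple of the multiplier of `Δ_h^r` for `h = e_j/2`. Summation by parts moves
the differences onto `f` (`exists_norm_integral_fourierInv_rieszSymbol_mul_le`). At scale `√v` this
gains `v^{-s/2}`, and the remaining `v`-integral is a Gamma integral
(`exists_norm_integral_fourierInv_radialSymbol_mul_le`). It converges at `0` because `|β| + iα > s`,
and its dependence on `b` gives the power of `t`. -/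

/-! ### Derivatives of `v^c exp(-b v^a)` -/

/-- The `m`-th derivative of `v ↦ v ^ c * exp (-b * v ^ a)` on `(0, ∞)`. -/
noncomputable def radialDeriv (a b : ℝ) : ℕ → ℝ → ℝ → ℝ
  | 0, c, v => v ^ c * Real.exp (-b * v ^ a)
  | m + 1, c, v => c * radialDeriv a b m (c - 1) v - a * b * radialDeriv a b m (c + a - 1) v

lemma hasDerivAt_radialDeriv (a b : ℝ) (m : ℕ) : ∀ (c : ℝ) {v : ℝ}, 0 < v →
    HasDerivAt (radialDeriv a b m c) (radialDeriv a b (m + 1) c v) v := by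
  induction m with
  | zero =>
    intro c v hv
    have h1 := Real.hasDerivAt_rpow_const (x := v) (p := c) (Or.inl hv.ne')
    have h2 := ((Real.hasDerivAt_rpow_const (x := v) (p := a) (Or.inl hv.ne')).const_mul (-b)).exp
    refine (h1.mul h2).congr_deriv ?_
    have h3 : v ^ (c + a - 1) = v ^ c * v ^ (a - 1) := by
      rw [← Real.rpow_add hv]; ring_nf
    simp only [radialDeriv, h3]
    ring
  | succ m ih =>
    intro c v hv
    exact ((ih (c - 1) hv).const_mul c).sub ((ih (c + a - 1) hv).const_mul (a * b))

lemma continuousOn_radialDeriv (a b : ℝ) (m : ℕ) (c : ℝ) :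
    ContinuousOn (radialDeriv a b m c) (Ioi 0) :=
  fun _ hv => (hasDerivAt_radialDeriv a b m c hv).continuousAt.continuousWithinAt

/-- Each differentiation costs a factor `1/v` or `b v^a / v`, and `b v^a` is the only way `b`
enters; hence a constant independent of `b`. -/
lemma exists_abs_radialDeriv_le_aux {a : ℝ} (ha : 0 < a) (m : ℕ) : ∀ c : ℝ, ∃ C : ℝ, 0 ≤ C ∧
    ∀ b v : ℝ, 0 < b → 0 < v → |radialDeriv a b m c v| ≤
      C * v ^ (c - m) * (1 + b * v ^ a) ^ m * Real.exp (-b * v ^ a) := by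
  induction m with
  | zero =>
    intro c
    refine ⟨1, zero_le_one, fun b v hb hv => ?_⟩
    simp only [radialDeriv]
    rw [abs_of_nonneg (by positivity)]
    simp
  | succ m ih =>
    intro c
    obtain ⟨C₁, h₁, H₁⟩ := ih (c - 1)
    obtain ⟨C₂, h₂, H₂⟩ := ih (c + a - 1)
    refine ⟨|c| * C₁ + a * C₂, by positivity, fun b v hb hv => ?_⟩
    have e1 : v ^ (c - 1 - m) = v ^ (c - (m + 1 : ℕ)) := by push_cast; ring_nf
    have e2 : v ^ (c + a - 1 - m) = v ^ (c - (m + 1 : ℕ)) * v ^ a := by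
      rw [← Real.rpow_add hv]; push_cast; ring_nf
    have B₁ := H₁ b v hb hv
    have B₂ := H₂ b v hb hv
    rw [e1] at B₁
    rw [e2] at B₂
    set V := v ^ (c - (m + 1 : ℕ))
    set y := v ^ a
    have hV : 0 ≤ V := by positivity
    have hy : 0 ≤ y := by positivity
    set X := Real.exp (-b * y)
    have hX : 0 ≤ X := by positivity
    have hp : 0 ≤ (1 + b * y) ^ m := by positivity
    calc |radialDeriv a b (m + 1) c v|
        ≤ |c * radialDeriv a b m (c - 1) v| + |a * b * radialDeriv a b m (c + a - 1) v| := by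
          rw [radialDeriv]; exact abs_sub _ _
      _ = |c| * |radialDeriv a b m (c - 1) v| + a * b * |radialDeriv a b m (c + a - 1) v| := by
          rw [abs_mul, abs_mul, abs_of_pos (mul_pos ha hb)]
      _ ≤ |c| * (C₁ * V * (1 + b * y) ^ m * X) + a * b * (C₂ * (V * y) * (1 + b * y) ^ m * X) := by
          gcongr
      _ = (|c| * C₁ + a * C₂ * (b * y)) * (V * (1 + b * y) ^ m * X) := by ring
      _ ≤ ((|c| * C₁ + a * C₂) * (1 + b * y)) * (V * (1 + b * y) ^ m * X) := by
          gcongr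
          have : 0 ≤ |c| * C₁ * (b * y) + a * C₂ := by positivity
          linarith
      _ = _ := by ring

/-- Half of the exponential absorbs the polynomial: `1 + y` is at most a constant times `exp(y /
(2(m+1)))`, whose `m`-th power is below `exp(y/2)`. -/
lemma one_add_pow_mul_exp_neg_le (m : ℕ) {y : ℝ} (hy : 0 ≤ y) :
    (1 + y) ^ m * Real.exp (-y) ≤ (2 * (m + 1)) ^ m * Real.exp (-y / 2) := by
  have hm : (0 : ℝ) < 2 * (m + 1) := by positivity
  have h1 : 1 + y ≤ 2 * (m + 1) * Real.exp (y / (2 * (m + 1))) := by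
    have := Real.add_one_le_exp (y / (2 * (m + 1)))
    have h2 : 2 * (m + 1 : ℝ) * (y / (2 * (m + 1)) + 1) = y + 2 * (m + 1) := by field_simp
    nlinarith [mul_le_mul_of_nonneg_left this hm.le, (Nat.cast_nonneg m : (0 : ℝ) ≤ m)]
  calc (1 + y) ^ m * Real.exp (-y)
      ≤ (2 * (m + 1) * Real.exp (y / (2 * (m + 1)))) ^ m * Real.exp (-y) := by gcongr
    _ = (2 * (m + 1)) ^ m * Real.exp (m * (y / (2 * (m + 1))) - y) := by
        rw [mul_pow, ← Real.exp_nat_mul, mul_assoc, ← Real.exp_add]; ring_nf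
    _ ≤ _ := by
        gcongr
        have : m * (y / (2 * (m + 1))) ≤ y / 2 := by
          rw [← mul_div_assoc, div_le_div_iff₀ hm two_pos]
          nlinarith
        linarith

lemma exists_abs_radialDeriv_le {a : ℝ} (ha : 0 < a) (m : ℕ) (c : ℝ) : ∃ C : ℝ, 0 ≤ C ∧
    ∀ b v : ℝ, 0 < b → 0 < v → |radialDeriv a b m c v| ≤
      C * (v ^ (c - m) * Real.exp (-(b / 2) * v ^ a)) := by
  obtain ⟨C, hC, H⟩ := exists_abs_radialDeriv_le_aux ha m c
  refine ⟨C * (2 * (m + 1)) ^ m, by positivity, fun b v hb hv => (H b v hb hv).trans ?_⟩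
  have h := one_add_pow_mul_exp_neg_le m (y := b * v ^ a) (by positivity)
  have e : -(b * v ^ a) / 2 = -(b / 2) * v ^ a := by ring
  rw [e, ← neg_mul] at h
  calc _ = (C * v ^ (c - m)) * ((1 + b * v ^ a) ^ m * Real.exp (-b * v ^ a)) := by ring
    _ ≤ (C * v ^ (c - m)) * ((2 * (m + 1)) ^ m * Real.exp (-(b / 2) * v ^ a)) := by gcongr
    _ = _ := by ring

/-- For `c = 0` the first derivative annihilates the constant term of `exp(-b v^a)` at `v = 0`. This
gains a factor `b v^a` over the general bound, which is what makes the kernel integrable when no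
derivative is taken. -/
lemma exists_abs_radialDeriv_zero_le {a : ℝ} (ha : 0 < a) (m : ℕ) : ∃ C : ℝ, 0 ≤ C ∧
    ∀ b v : ℝ, 0 < b → 0 < v → |radialDeriv a b (m + 1) 0 v| ≤
      b * C * (v ^ (a - (m + 1 : ℕ)) * Real.exp (-(b / 2) * v ^ a)) := by
  obtain ⟨C, hC, H⟩ := exists_abs_radialDeriv_le ha m (0 + a - 1)
  refine ⟨a * C, by positivity, fun b v hb hv => ?_⟩
  rw [radialDeriv, zero_mul, zero_sub, abs_neg, abs_mul, abs_of_pos (mul_pos ha hb)]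
  have e : v ^ (0 + a - 1 - m) = v ^ (a - (m + 1 : ℕ)) := by push_cast; ring_nf
  have := H b v hb hv
  rw [e] at this
  calc _ ≤ a * b * (C * (v ^ (a - (m + 1 : ℕ)) * Real.exp (-(b / 2) * v ^ a))) := by gcongr
    _ = _ := by ring

/-! ### Taylor's formula based at infinity -/

lemma hasDerivAt_sum_radialDeriv (a b c x : ℝ) {v : ℝ} (hv : 0 < v) (K : ℕ) :
    HasDerivAt (fun v => ∑ k ∈ Finset.range (K + 1),
        (x - v) ^ k / (k.factorial : ℝ) * radialDeriv a b k c v)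
      ((x - v) ^ K / (K.factorial : ℝ) * radialDeriv a b (K + 1) c v) v := by
  induction K with
  | zero => simpa using hasDerivAt_radialDeriv a b 0 c hv
  | succ K ih =>
    simp_rw [Finset.sum_range_succ _ (K + 1)]
    have h1 : HasDerivAt (fun v => (x - v) ^ (K + 1) / ((K + 1).factorial : ℝ))
        (-((x - v) ^ K / (K.factorial : ℝ))) v := by
      have := (((hasDerivAt_id v).const_sub x).pow (K + 1)).div_const ((K + 1).factorial : ℝ)
      refine this.congr_deriv ?_
      simp only [Nat.factorial_succ, id]
      push_cast
      have : (K.factorial : ℝ) ≠ 0 := by positivity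
      have : (K + 1 : ℝ) ≠ 0 := by positivity
      field_simp
    refine (ih.add (h1.mul (hasDerivAt_radialDeriv a b (K + 1) c hv))).congr_deriv ?_
    ring

lemma tendsto_rpow_mul_exp_neg_mul_rpow {a b : ℝ} (ha : 0 < a) (hb : 0 < b) (c : ℝ) :
    Filter.Tendsto (fun v : ℝ => v ^ c * Real.exp (-b * v ^ a)) Filter.atTop (nhds 0) := by
  have h := (tendsto_rpow_mul_exp_neg_mul_atTop_nhds_zero (c / a) b hb).comp (tendsto_rpow_atTop ha)
  refine h.congr' ?_
  filter_upwards [Filter.eventually_gt_atTop 0] with v hv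
  simp only [Function.comp]
  rw [← Real.rpow_mul hv.le, mul_div_cancel₀ _ ha.ne']

lemma integrableOn_rpow_mul_exp_neg_Ioi {a b x : ℝ} (ha : 0 < a) (hb : 0 < b) (hx : 0 < x)
    (p : ℝ) : IntegrableOn (fun v : ℝ => v ^ p * Real.exp (-b * v ^ a)) (Ioi x) := by
  -- Integrability down to `0` needs an exponent above `-1`; away from `0` the exponent `p` can be
  -- raised to `max p 0` at the cost of a constant.
  have h := (integrableOn_rpow_mul_exp_neg_mul_rpow (s := max p 0) (p := a) (b := b)
    (by have := le_max_right p 0; linarith) ha hb).mono_set (Ioi_subset_Ioi hx.le)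
  refine (h.const_mul (x ^ (p - max p 0))).mono' ?_ ?_
  · refine (ContinuousOn.mul ?_ ?_).aestronglyMeasurable measurableSet_Ioi
    · exact fun v hv => (Real.continuousAt_rpow_const v p
        (Or.inl (hx.trans hv).ne')).continuousWithinAt
    · exact (Real.continuous_exp.comp (continuous_const.mul
        (Real.continuous_rpow_const ha.le))).continuousOn
  · filter_upwards [ae_restrict_mem measurableSet_Ioi] with v hv
    have hv0 : 0 < v := hx.trans hv
    rw [Real.norm_of_nonneg (by positivity), ← mul_assoc]
    gcongr
    calc v ^ p = v ^ (p - max p 0) * v ^ (max p 0) := by rw [← Real.rpow_add hv0]; ring_nf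
      _ ≤ _ := by
        gcongr ?_ * _
        exact Real.rpow_le_rpow_of_nonpos hx (le_of_lt hv) (by have := le_max_left p 0; linarith)

/-- The weight which represents `x ↦ x ^ c * exp (-b * x ^ a)` through truncated powers. -/
noncomputable def taylorWeight (a b : ℝ) (K : ℕ) (c v : ℝ) : ℝ :=
  (-1) ^ (K + 1) / (K.factorial : ℝ) * radialDeriv a b (K + 1) c v

lemma continuousOn_taylorWeight (a b : ℝ) (K : ℕ) (c : ℝ) :
    ContinuousOn (taylorWeight a b K c) (Ioi 0) :=
  continuousOn_const.mul (continuousOn_radialDeriv a b (K + 1) c)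

lemma abs_taylorWeight_le (a b : ℝ) (K : ℕ) (c v : ℝ) :
    |taylorWeight a b K c v| ≤ |radialDeriv a b (K + 1) c v| := by
  rw [taylorWeight, abs_mul, abs_div, abs_pow, abs_neg, abs_one, one_pow, Nat.abs_cast]
  refine mul_le_of_le_one_left (abs_nonneg _) ?_
  rw [div_le_one (by positivity)]
  exact_mod_cast Nat.one_le_iff_ne_zero.2 (Nat.factorial_ne_zero K)

/-- The `v`-derivative of the Taylor sum of order `K` about `v`, evaluated at `x`, telescopes to the
remainder integrand. The sum tends to `0` as `v → ∞` and reduces to its zeroth term at `v = x`. -/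
theorem integral_truncatedPow_mul_taylorWeight {a b x : ℝ} (ha : 0 < a) (hb : 0 < b) (hx : 0 < x)
    {K : ℕ} (hK : K ≠ 0) (c : ℝ) :
    ∫ v in Ioi 0, (max (v - x) 0) ^ K * taylorWeight a b K c v
      = x ^ c * Real.exp (-b * x ^ a) := by
  obtain ⟨C, hC, H⟩ := exists_abs_radialDeriv_le ha (K + 1) c
  have hint : IntegrableOn
      (fun v => (x - v) ^ K / (K.factorial : ℝ) * radialDeriv a b (K + 1) c v) (Ioi x) := by
    refine ((integrableOn_rpow_mul_exp_neg_Ioi ha (half_pos hb) hx (c - 1)).const_mul C).mono' ?_ ?_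
    · refine ContinuousOn.aestronglyMeasurable (ContinuousOn.mul (by fun_prop)
        ((continuousOn_radialDeriv a b (K + 1) c).mono (Ioi_subset_Ioi hx.le))) measurableSet_Ioi
    · filter_upwards [ae_restrict_mem measurableSet_Ioi] with v hv
      have hv0 : 0 < v := hx.trans hv
      have h1 : |(x - v) ^ K / (K.factorial : ℝ)| ≤ v ^ K := by
        rw [abs_div, abs_pow, Nat.abs_cast]
        refine (div_le_self (by positivity) ?_).trans ?_
        · exact_mod_cast Nat.one_le_iff_ne_zero.2 (Nat.factorial_ne_zero K)
        · gcongr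
          rw [abs_sub_comm, abs_of_nonneg (sub_nonneg.2 (le_of_lt hv))]
          linarith
      rw [norm_mul, Real.norm_eq_abs, Real.norm_eq_abs]
      calc _ ≤ v ^ K * (C * (v ^ (c - (K + 1 : ℕ)) * Real.exp (-(b / 2) * v ^ a))) := by
            gcongr
            exact H b v hb hv0
        _ = C * ((v ^ (K : ℝ) * v ^ (c - (K + 1 : ℕ))) * Real.exp (-(b / 2) * v ^ a)) := by
            rw [Real.rpow_natCast]; ring
        _ = _ := by rw [← Real.rpow_add hv0]; push_cast; ring_nf
  have hlim : Filter.Tendsto (fun v => ∑ k ∈ Finset.range (K + 1),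
      (x - v) ^ k / (k.factorial : ℝ) * radialDeriv a b k c v) Filter.atTop (nhds 0) := by
    rw [← Finset.sum_const_zero (s := Finset.range (K + 1))]
    refine tendsto_finsetSum _ fun k _ => ?_
    obtain ⟨C, hC, H⟩ := exists_abs_radialDeriv_le ha k c
    have := (tendsto_rpow_mul_exp_neg_mul_rpow ha (half_pos hb) c).const_mul C
    rw [mul_zero] at this
    refine squeeze_zero_norm' ?_ this
    filter_upwards [Filter.eventually_gt_atTop x] with v hv
    have hv0 : 0 < v := hx.trans hv
    have h1 : |(x - v) ^ k / (k.factorial : ℝ)| ≤ v ^ k := by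
      rw [abs_div, abs_pow, Nat.abs_cast]
      refine (div_le_self (by positivity) ?_).trans ?_
      · exact_mod_cast Nat.one_le_iff_ne_zero.2 (Nat.factorial_ne_zero k)
      · gcongr
        rw [abs_sub_comm, abs_of_nonneg (sub_nonneg.2 (le_of_lt hv))]
        linarith
    rw [norm_mul, Real.norm_eq_abs, Real.norm_eq_abs]
    calc _ ≤ v ^ k * (C * (v ^ (c - k) * Real.exp (-(b / 2) * v ^ a))) := by
          gcongr
          exact H b v hb hv0
      _ = C * ((v ^ (k : ℝ) * v ^ (c - k)) * Real.exp (-(b / 2) * v ^ a)) := by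
          rw [Real.rpow_natCast]; ring
      _ = _ := by rw [← Real.rpow_add hv0]; ring_nf
  have hmain := integral_Ioi_of_hasDerivAt_of_tendsto'
    (fun v hv => hasDerivAt_sum_radialDeriv a b c x (hx.trans_le hv) K) hint hlim
  have hx0 : ∑ k ∈ Finset.range (K + 1), (x - x) ^ k / (k.factorial : ℝ) * radialDeriv a b k c x
      = x ^ c * Real.exp (-b * x ^ a) := by
    rw [Finset.sum_range_succ', Finset.sum_eq_zero]
    · simp [radialDeriv]
    · intro k _; simp
  rw [hx0, zero_sub] at hmain
  rw [setIntegral_eq_of_subset_of_forall_sdiff_eq_zero measurableSet_Ioi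
    (Ioi_subset_Ioi hx.le) (s := Ioi x), ← neg_eq_iff_eq_neg.2 hmain, ← integral_neg]
  · refine setIntegral_congr_fun measurableSet_Ioi fun v hv => ?_
    have hv : x < v := hv
    simp only [taylorWeight]
    rw [max_eq_left (by linarith), ← neg_sub v x, neg_pow (v - x) K, pow_succ]
    ring
  · rintro v ⟨hv, hv'⟩
    simp only [mem_Ioi, not_lt] at hv hv'
    -- Below `x` the truncated power vanishes, which requires `K ≠ 0` since `0 ^ 0 = 1`.
    rw [max_eq_right (by linarith), zero_pow hK, zero_mul]

/-! ### Smoothness of truncated powers -/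

lemma hasDerivAt_truncatedPow (m : ℕ) (x : ℝ) :
    HasDerivAt (fun x : ℝ => (max x 0) ^ (m + 2)) ((m + 2) * (max x 0) ^ (m + 1)) x := by
  rcases lt_trichotomy x 0 with hx | rfl | hx
  · have h : (fun x : ℝ => (max x 0) ^ (m + 2)) =ᶠ[nhds x] fun _ => 0 := by
      filter_upwards [gt_mem_nhds hx] with y hy
      simp [max_eq_right (le_of_lt hy)]
    rw [max_eq_right hx.le, zero_pow (by simp), mul_zero]
    exact (hasDerivAt_const x (0 : ℝ)).congr_of_eventuallyEq h
  · rw [max_self, zero_pow (by simp), mul_zero]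
    refine HasDerivAt.congr_deriv (f' := 0) ?_ rfl
    rw [hasDerivAt_iff_isLittleO_nhds_zero]
    simp only [zero_add, max_self, ne_eq, Nat.add_eq_zero_iff, OfNat.ofNat_ne_zero, and_false,
      not_false_eq_true, zero_pow, sub_zero, smul_zero]
    refine Asymptotics.IsBigO.trans_isLittleO (g := fun h : ℝ => h ^ (m + 2)) ?_ ?_
    · refine Asymptotics.IsBigO.of_bound 1 (Filter.Eventually.of_forall fun h => ?_)
      rw [one_mul, norm_pow, norm_pow]
      gcongr
      rw [Real.norm_of_nonneg (le_max_right _ _)]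
      exact max_le (le_abs_self h) (norm_nonneg h)
    · simpa using Asymptotics.isLittleO_pow_pow (𝕜 := ℝ) (show 1 < m + 2 by omega)
  · have h : (fun x : ℝ => (max x 0) ^ (m + 2)) =ᶠ[nhds x] fun x => x ^ (m + 2) := by
      filter_upwards [lt_mem_nhds hx] with y hy
      simp [max_eq_left (le_of_lt hy)]
    rw [max_eq_left hx.le]
    refine ((hasDerivAt_pow (m + 2) x).congr_deriv ?_).congr_of_eventuallyEq h
    push_cast; rfl

lemma contDiff_truncatedPow (m : ℕ) : ContDiff ℝ m (fun x : ℝ => (max x 0) ^ (m + 1)) := by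
  induction m with
  | zero =>
    rw [Nat.cast_zero, contDiff_zero]
    fun_prop
  | succ m ih =>
    rw [Nat.cast_succ, contDiff_succ_iff_deriv]
    refine ⟨fun x => (hasDerivAt_truncatedPow m x).differentiableAt, by simp, ?_⟩
    rw [show deriv (fun x : ℝ => (max x 0) ^ (m + 1 + 1)) = fun x : ℝ => (m + 2) * (max x 0) ^ (m + 1)
      from funext fun x => (hasDerivAt_truncatedPow m x).deriv]
    exact contDiff_const.mul ih

/-! ### Decay of inverse Fourier transforms and Bochner-Riesz symbols -/

variable {V : Type*} [NormedAddCommGroup V] [InnerProductSpace ℝ V] [FiniteDimensional ℝ V]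
  [MeasurableSpace V] [BorelSpace V]

/-- Each derivative of `g` is worth one power of decay; one more than the dimension suffices for
integrability. -/
lemma exists_norm_fourierInv_le {g : V → ℂ} (hg : ContDiff ℝ (Module.finrank ℝ V + 1 : ℕ) g)
    (hc : HasCompactSupport g) :
    ∃ C : ℝ, 0 ≤ C ∧ ∀ y, ‖𝓕⁻ g y‖ ≤ C * (1 + ‖y‖) ^ (-(Module.finrank ℝ V + 1 : ℝ)) := by
  set D := Module.finrank ℝ V
  have hint : ∀ (k m : ℕ), (k : ℕ∞) ≤ (0 : ℕ∞) → (m : ℕ∞) ≤ ((D + 1 : ℕ) : ℕ∞) →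
      Integrable (fun v => ‖v‖ ^ k * ‖iteratedFDeriv ℝ m g v‖) := by
    intro k m _ hm
    have hm' : m ≤ D + 1 := by exact_mod_cast hm
    refine Continuous.integrable_of_hasCompactSupport ?_ ?_
    · exact (continuous_norm.pow k).mul
        (hg.continuous_iteratedFDeriv (by exact_mod_cast hm')).norm
    · exact ((hc.iteratedFDeriv m).norm).mul_left
  have key := fun (m : ℕ) (hm : (m : ℕ∞) ≤ ((D + 1 : ℕ) : ℕ∞)) (w : V) =>
    Real.pow_mul_norm_iteratedFDeriv_fourier_le (f := g) (K := 0) (N := ((D + 1 : ℕ) : ℕ∞))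
    (by exact_mod_cast hg) hint (k := 0) (n := m) (by simp) hm w
  simp only [norm_iteratedFDeriv_zero] at key
  obtain ⟨A, hA⟩ : ∃ A, ∀ w : V, ‖w‖ ^ (D + 1) * ‖𝓕 g w‖ ≤ A := ⟨_, key (D + 1) le_rfl⟩
  obtain ⟨A', hA'⟩ : ∃ A, ∀ w : V, ‖w‖ ^ 0 * ‖𝓕 g w‖ ≤ A := ⟨_, key 0 (by simp)⟩
  have hA0 : 0 ≤ A := (by positivity : (0:ℝ) ≤ ‖(0 : V)‖ ^ (D + 1) * ‖𝓕 g 0‖).trans (hA 0)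
  have hA0' : 0 ≤ A' := (by positivity : (0:ℝ) ≤ ‖(0 : V)‖ ^ 0 * ‖𝓕 g 0‖).trans (hA' 0)
  refine ⟨2 ^ D * (A' + A), by positivity, fun y => ?_⟩
  rw [Real.rpow_neg (by positivity), ← div_eq_mul_inv, le_div_iff₀ (by positivity),
    Real.fourierInv_eq_fourier_neg, ← Nat.cast_succ, Real.rpow_natCast]
  have h1 := hA (-y)
  have h2 := hA' (-y)
  rw [norm_neg] at h1 h2
  calc ‖𝓕 g (-y)‖ * (1 + ‖y‖) ^ (D + 1)
      ≤ ‖𝓕 g (-y)‖ * (2 ^ D * (1 ^ (D + 1) + ‖y‖ ^ (D + 1))) := by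
        gcongr
        exact add_pow_le zero_le_one (norm_nonneg y) (D + 1)
    _ = 2 ^ D * (‖y‖ ^ 0 * ‖𝓕 g (-y)‖ + ‖y‖ ^ (D + 1) * ‖𝓕 g (-y)‖) := by ring
    _ ≤ _ := by gcongr

lemma continuous_fourierInv {g : V → ℂ} (hg : Integrable g) : Continuous (𝓕⁻ g) := by
  have h : 𝓕⁻ g = fun x => 𝓕 g (-x) := funext fun x => Real.fourierInv_eq_fourier_neg g x
  rw [h]
  exact (VectorFourier.fourierIntegral_continuous Real.continuous_fourierChar
    (by exact continuous_inner) hg).comp continuous_neg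

lemma integrable_of_norm_le_one_add_norm_rpow {g : V → ℂ} (hg : Continuous g) {C q : ℝ}
    (hq : (Module.finrank ℝ V : ℝ) < q) (h : ∀ y, ‖g y‖ ≤ C * (1 + ‖y‖) ^ (-q)) :
    Integrable g :=
  ((integrable_one_add_norm hq).const_mul C).mono' hg.aestronglyMeasurable (ae_of_all _ h)

lemma integrable_fourierInv {g : V → ℂ} (hg : ContDiff ℝ (Module.finrank ℝ V + 1 : ℕ) g)
    (hc : HasCompactSupport g) : Integrable (𝓕⁻ g) := by
  obtain ⟨C, -, h⟩ := exists_norm_fourierInv_le hg hc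
  exact integrable_of_norm_le_one_add_norm_rpow (continuous_fourierInv
    (hg.continuous.integrable_of_hasCompactSupport hc)) (lt_add_one _) h

/-- A function `p` times the Bochner-Riesz symbol `(1 - ‖ξ‖ ^ 2)₊ ^ K`. -/
noncomputable def rieszSymbol (p : V → ℝ) (K : ℕ) (ξ : V) : ℂ :=
  (p ξ * (max (1 - ‖ξ‖ ^ 2) 0) ^ K : ℝ)

lemma contDiff_truncatedPow_norm {m K : ℕ} (hK : m + 1 = K) :
    ContDiff ℝ m (fun ξ : V => (max (1 - ‖ξ‖ ^ 2) 0) ^ K) := by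
  subst hK
  exact (contDiff_truncatedPow m).comp (contDiff_const.sub (contDiff_norm_sq ℝ))

lemma contDiff_rieszSymbol {p : V → ℝ} (hp : ContDiff ℝ ∞ p) {m K : ℕ} (hK : m + 1 = K) :
    ContDiff ℝ m (rieszSymbol p K) :=
  Complex.ofRealCLM.contDiff.comp ((hp.of_le (by exact_mod_cast le_top)).mul
    (contDiff_truncatedPow_norm hK))

lemma rieszSymbol_eq_zero (p : V → ℝ) {K : ℕ} (hK : K ≠ 0) {ξ : V} (hξ : 1 ≤ ‖ξ‖) :
    rieszSymbol p K ξ = 0 := by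
  have : 1 - ‖ξ‖ ^ 2 ≤ 0 := by nlinarith
  simp [rieszSymbol, max_eq_right this, hK]

lemma hasCompactSupport_rieszSymbol (p : V → ℝ) {K : ℕ} (hK : K ≠ 0) :
    HasCompactSupport (rieszSymbol p K) :=
  HasCompactSupport.of_support_subset_isCompact (isCompact_closedBall (0 : V) 1) fun ξ hξ => by
    by_contra h
    rw [mem_closedBall_zero_iff, not_le] at h
    exact hξ (rieszSymbol_eq_zero p hK h.le)

lemma integrable_rieszSymbol {p : V → ℝ} (hp : ContDiff ℝ ∞ p) {K : ℕ} (hK : K ≠ 0) :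
    Integrable (rieszSymbol p K) :=
  (contDiff_rieszSymbol hp (m := K - 1) (by omega)).continuous.integrable_of_hasCompactSupport
    (hasCompactSupport_rieszSymbol p hK)

lemma mul_truncatedPow_eq {p : V → ℝ} {d : ℕ} (hd : ∀ R : ℝ, 0 < R → ∀ ξ, p (R • ξ) = R ^ d * p ξ)
    (K : ℕ) {R : ℝ} (hR : 0 < R) (ξ : V) :
    ((p ξ * (max (R ^ 2 - ‖ξ‖ ^ 2) 0) ^ K : ℝ) : ℂ)
      = (R ^ (2 * K + d) : ℝ) * rieszSymbol p K (R⁻¹ • ξ) := by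
  have h1 : p ξ = R ^ d * p (R⁻¹ • ξ) := by
    rw [← hd R hR, smul_smul, mul_inv_cancel₀ hR.ne', one_smul]
  have h2 : max (R ^ 2 - ‖ξ‖ ^ 2) 0 = R ^ 2 * max (1 - ‖R⁻¹ • ξ‖ ^ 2) 0 := by
    rw [mul_max_of_nonneg _ _ (by positivity), norm_smul, norm_inv, Real.norm_of_nonneg hR.le]
    congr 1
    · field_simp
    · ring
  rw [rieszSymbol, ← Complex.ofReal_mul]
  congr 1
  rw [h1, h2, mul_pow, pow_add, pow_mul]
  ring

lemma integral_fourierChar_comp_inv_smul (g : V → ℂ) {R : ℝ} (hR : 0 < R) (x : V) :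
    ∫ ξ, Real.fourierChar (inner ℝ ξ x) • g (R⁻¹ • ξ)
      = (R ^ Module.finrank ℝ V : ℝ) * 𝓕⁻ g (R • x) := by
  have h := Measure.integral_comp_smul (volume : Measure V)
    (fun ξ => Real.fourierChar (inner ℝ ξ (R • x)) • g ξ) R⁻¹
  have e : ∀ ξ : V, inner ℝ (R⁻¹ • ξ) (R • x) = inner ℝ ξ x := fun ξ => by
    rw [real_inner_smul_left, real_inner_smul_right, inv_mul_cancel_left₀ hR.ne']
  simp only [e] at h
  rw [h, Real.fourierInv_eq, inv_pow, inv_inv, abs_of_pos (by positivity), Complex.real_smul]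

lemma integral_norm_comp_inv_smul (g : V → ℂ) {R : ℝ} (hR : 0 < R) :
    ∫ ξ, ‖g (R⁻¹ • ξ)‖ = R ^ Module.finrank ℝ V * ∫ ξ, ‖g ξ‖ := by
  have h := Measure.integral_comp_smul (volume : Measure V) (fun ξ => ‖g ξ‖) R⁻¹
  rw [h, inv_pow, inv_inv, abs_of_pos (by positivity), smul_eq_mul]

/-! ### Radial symbols as superpositions of Bochner-Riesz symbols -/

/-- The symbol `p ξ * |ξ| ^ (2 * c) * exp (-b * |ξ| ^ (2 * a))`. -/
noncomputable def radialSymbol (p : V → ℝ) (a b c : ℝ) (ξ : V) : ℂ :=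
  (p ξ * ((‖ξ‖ ^ 2) ^ c * Real.exp (-b * (‖ξ‖ ^ 2) ^ a)) : ℝ)

/-- The density of the representation of `𝓕⁻ (radialSymbol p a b c)` by dilates of
`𝓕⁻ (rieszSymbol p K)`. -/
noncomputable def rieszDensity (a b c : ℝ) (K m : ℕ) (v : ℝ) : ℝ :=
  taylorWeight a b K c v * √v ^ (2 * K + m)

lemma continuousOn_rieszDensity (a b c : ℝ) (K m : ℕ) :
    ContinuousOn (rieszDensity a b c K m) (Ioi 0) :=
  (continuousOn_taylorWeight a b K c).mul (by fun_prop)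

section Representation

variable {p : V → ℝ} (hp : ContDiff ℝ ∞ p) {d : ℕ}
  (hd : ∀ R : ℝ, 0 < R → ∀ ξ, p (R • ξ) = R ^ d * p ξ)

include hp hd in
lemma integrable_prod_rieszSymbol {a b c : ℝ} {K : ℕ} (hK : K ≠ 0)
    (hw : IntegrableOn (rieszDensity a b c K (d + Module.finrank ℝ V)) (Ioi 0)) (x : V) :
    Integrable (fun q : V × ℝ => Real.fourierChar (inner ℝ q.1 x) •
      ((p q.1 * (max (q.2 - ‖q.1‖ ^ 2) 0) ^ K * taylorWeight a b K c q.2 : ℝ) : ℂ))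
      ((volume : Measure V).prod (volume.restrict (Ioi (0 : ℝ)))) := by
  have hpc : Continuous p := hp.continuous
  have hmeas : AEStronglyMeasurable (fun q : V × ℝ => Real.fourierChar (inner ℝ q.1 x) •
      ((p q.1 * (max (q.2 - ‖q.1‖ ^ 2) 0) ^ K * taylorWeight a b K c q.2 : ℝ) : ℂ))
      ((volume : Measure V).prod (volume.restrict (Ioi (0 : ℝ)))) := by
    have h1 : AEStronglyMeasurable (taylorWeight a b K c) (volume.restrict (Ioi (0 : ℝ))) :=
      (continuousOn_taylorWeight a b K c).aestronglyMeasurable measurableSet_Ioi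
    have h2 : Continuous (fun q : V × ℝ => (p q.1 * (max (q.2 - ‖q.1‖ ^ 2) 0) ^ K : ℝ)) := by
      fun_prop
    have h3 : Continuous (fun q : V × ℝ => (Real.fourierChar (inner ℝ q.1 x) : ℂ)) :=
      continuous_subtype_val.comp (Real.continuous_fourierChar.comp (by fun_prop))
    refine AEStronglyMeasurable.smul (f := fun q : V × ℝ =>
      (Real.fourierChar (inner ℝ q.1 x) : ℂ)) h3.aestronglyMeasurable ?_
    exact Complex.continuous_ofReal.comp_aestronglyMeasurable
      (h2.aestronglyMeasurable.mul h1.comp_snd)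
  rw [integrable_prod_iff' hmeas]
  have heq : ∀ v : ℝ, 0 < v → ∀ ξ : V,
      ‖Real.fourierChar (inner ℝ ξ x) •
        ((p ξ * (max (v - ‖ξ‖ ^ 2) 0) ^ K * taylorWeight a b K c v : ℝ) : ℂ)‖
      = |taylorWeight a b K c v| * √v ^ (2 * K + d) * ‖rieszSymbol p K ((√v)⁻¹ • ξ)‖ := by
    intro v hv ξ
    have := mul_truncatedPow_eq hd K (Real.sqrt_pos.2 hv) ξ
    rw [Real.sq_sqrt hv.le] at this
    rw [Circle.norm_smul, Complex.ofReal_mul, this, norm_mul, norm_mul, Complex.norm_real,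
      Complex.norm_real, Real.norm_eq_abs, Real.norm_eq_abs, abs_of_nonneg (by positivity)]
    ring
  constructor
  · filter_upwards [ae_restrict_mem measurableSet_Ioi] with v hv
    have hv : 0 < v := hv
    have hc : Continuous (fun ξ : V => Real.fourierChar (inner ℝ ξ x) •
        ((p ξ * (max (v - ‖ξ‖ ^ 2) 0) ^ K * taylorWeight a b K c v : ℝ) : ℂ)) := by
      have h3 : Continuous (fun ξ : V => (Real.fourierChar (inner ℝ ξ x) : ℂ)) :=
        continuous_subtype_val.comp (Real.continuous_fourierChar.comp (by fun_prop))
      refine Continuous.smul (f := fun ξ : V => (Real.fourierChar (inner ℝ ξ x) : ℂ)) h3 ?_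
      have h4 : Continuous (fun ξ : V =>
          p ξ * (max (v - ‖ξ‖ ^ 2) 0) ^ K * taylorWeight a b K c v) := by fun_prop
      exact Complex.continuous_ofReal.comp h4
    rw [← integrable_norm_iff hc.aestronglyMeasurable]
    simp only [heq v hv]
    exact ((integrable_rieszSymbol hp hK).comp_smul
      (inv_ne_zero (Real.sqrt_pos.2 hv).ne')).norm.const_mul _
  · refine ((hw.norm).mul_const (∫ ξ, ‖rieszSymbol p K ξ‖)).congr ?_
    filter_upwards [ae_restrict_mem measurableSet_Ioi] with v hv
    have hv : 0 < v := hv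
    simp only [heq v hv]
    rw [integral_const_mul, integral_norm_comp_inv_smul _ (Real.sqrt_pos.2 hv), rieszDensity,
      norm_mul, Real.norm_eq_abs, Real.norm_of_nonneg (by positivity), ← add_assoc, pow_add]
    ring

include hp hd in
-- Taylor's formula at `x = |ξ|^2`, then Fubini and the dilation `ξ ↦ ξ/√v`. In the density, `√v`
-- carries the power `2K + d` from homogeneity and `finrank ℝ V` from the Jacobian.
theorem fourierInv_radialSymbol_eq [Nontrivial V] {a b c : ℝ} (ha : 0 < a) (hb : 0 < b) {K : ℕ}
    (hK : K ≠ 0) (hw : IntegrableOn (rieszDensity a b c K (d + Module.finrank ℝ V)) (Ioi 0))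
    (x : V) :
    𝓕⁻ (radialSymbol p a b c) x = ∫ v in Ioi (0 : ℝ),
      (rieszDensity a b c K (d + Module.finrank ℝ V) v : ℂ) * 𝓕⁻ (rieszSymbol p K) (√v • x) := by
  -- Taylor's formula is available only for `|ξ|^2 > 0`; nontriviality of `V` makes the origin a
  -- null set.
  have h0 : ∀ᵐ ξ : V, ξ ≠ 0 := by
    simp [ae_iff]
  have h1 : 𝓕⁻ (radialSymbol p a b c) x = ∫ ξ : V, ∫ v in Ioi (0 : ℝ),
      Real.fourierChar (inner ℝ ξ x) •
        ((p ξ * (max (v - ‖ξ‖ ^ 2) 0) ^ K * taylorWeight a b K c v : ℝ) : ℂ) := by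
    rw [Real.fourierInv_eq]
    refine integral_congr_ae ?_
    filter_upwards [h0] with ξ hξ
    have hξ : 0 < ‖ξ‖ ^ 2 := by positivity
    simp only [radialSymbol]
    rw [← integral_truncatedPow_mul_taylorWeight ha hb hξ hK c]
    simp only [Circle.smul_def, smul_eq_mul]
    rw [integral_const_mul, integral_complex_ofReal]
    congr 2
    rw [← integral_const_mul]
    simp only [mul_assoc]
  rw [h1, integral_integral_swap (integrable_prod_rieszSymbol hp hd hK hw x)]
  refine setIntegral_congr_fun measurableSet_Ioi fun v hv => ?_
  have hv : 0 < v := hv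
  have h2 : ∀ ξ : V, Real.fourierChar (inner ℝ ξ x) •
        ((p ξ * (max (v - ‖ξ‖ ^ 2) 0) ^ K * taylorWeight a b K c v : ℝ) : ℂ)
      = (taylorWeight a b K c v * √v ^ (2 * K + d) : ℝ) *
        (Real.fourierChar (inner ℝ ξ x) • rieszSymbol p K ((√v)⁻¹ • ξ)) := by
    intro ξ
    have := mul_truncatedPow_eq hd K (Real.sqrt_pos.2 hv) ξ
    rw [Real.sq_sqrt hv.le] at this
    rw [Complex.ofReal_mul, this]
    simp only [Circle.smul_def, smul_eq_mul]
    push_cast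
    ring
  simp only [h2]
  rw [integral_const_mul, integral_fourierChar_comp_inv_smul _ (Real.sqrt_pos.2 hv), rieszDensity]
  push_cast
  ring

end Representation

/-! ### Pointwise decay of the kernels -/

/-- The bound `A * v ^ (e - (K + 1)) * exp (-(b / 2) * v ^ a)` of a Taylor weight, multiplied by
the density factor. -/
lemma abs_rieszDensity_le {a b c e A : ℝ} {K m : ℕ} {v : ℝ} (hv : 0 < v)
    (h : |taylorWeight a b K c v| ≤
      A * (v ^ (e - (K + 1 : ℕ)) * Real.exp (-(b / 2) * v ^ a))) :
    |rieszDensity a b c K m v| ≤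
      A * (v ^ (e + m / 2 - 1) * Real.exp (-(b / 2) * v ^ a)) := by
  have h1 : √v ^ (2 * K + m) = v ^ (K + m / 2 : ℝ) := by
    rw [Real.sqrt_eq_rpow, ← Real.rpow_natCast, ← Real.rpow_mul hv.le]
    push_cast; ring_nf
  rw [rieszDensity, abs_mul, h1, abs_of_nonneg (by positivity : (0 : ℝ) ≤ v ^ (K + m / 2 : ℝ))]
  calc _ ≤ A * (v ^ (e - (K + 1 : ℕ)) * Real.exp (-(b / 2) * v ^ a)) * v ^ (K + m / 2 : ℝ) := by
        gcongr
    _ = A * ((v ^ (e - (K + 1 : ℕ)) * v ^ (K + m / 2 : ℝ)) * Real.exp (-(b / 2) * v ^ a)) := by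
        ring
    _ = _ := by
        rw [← Real.rpow_add hv]; push_cast; ring_nf

lemma integrableOn_rieszDensity {a b c e A : ℝ} {K m : ℕ} (ha : 0 < a) (hb : 0 < b)
    (he : 0 < e + m / 2)
    (h : ∀ v : ℝ, 0 < v → |taylorWeight a b K c v| ≤
      A * (v ^ (e - (K + 1 : ℕ)) * Real.exp (-(b / 2) * v ^ a))) :
    IntegrableOn (rieszDensity a b c K m) (Ioi 0) := by
  refine ((integrableOn_rpow_mul_exp_neg_mul_rpow (s := e + m / 2 - 1) (p := a) (b := b / 2)
    (by linarith) ha (half_pos hb)).const_mul A).mono'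
    ((continuousOn_rieszDensity a b c K m).aestronglyMeasurable measurableSet_Ioi) ?_
  filter_upwards [ae_restrict_mem measurableSet_Ioi] with v hv
  exact abs_rieszDensity_le hv (h v hv)

lemma one_add_mul_rpow_neg_le {v y q : ℝ} (hv : 0 < v) (hy : 0 ≤ y) (hq : 0 ≤ q) :
    (1 + √v * y) ^ (-q) ≤ (1 + v ^ (-(q / 2))) * (1 + y) ^ (-q) := by
  have hs : 0 < √v := Real.sqrt_pos.2 hv
  rcases le_total 1 v with h | h
  · have h1 : 1 ≤ √v := Real.one_le_sqrt.2 h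
    calc (1 + √v * y) ^ (-q) ≤ (1 + y) ^ (-q) := by
          refine Real.rpow_le_rpow_of_nonpos (by positivity) ?_ (by linarith)
          nlinarith
      _ ≤ _ := le_mul_of_one_le_left (by positivity) (by
          have : 0 ≤ v ^ (-(q / 2)) := by positivity
          linarith)
  · have h1 : √v ≤ 1 := Real.sqrt_le_one.2 h
    calc (1 + √v * y) ^ (-q) ≤ (√v * (1 + y)) ^ (-q) := by
          refine Real.rpow_le_rpow_of_nonpos (by positivity) ?_ (by linarith)
          nlinarith
      _ = v ^ (-(q / 2)) * (1 + y) ^ (-q) := by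
          rw [Real.mul_rpow hs.le (by positivity), Real.sqrt_eq_rpow, ← Real.rpow_mul hv.le]
          ring_nf
      _ ≤ _ := by
          gcongr
          linarith

/-- The decay of the Bochner-Riesz kernel at `√v x` is split into a power of `v` and a power of `1 +
|x|`, and the power of `v` is integrated against the density. The bound on the weight is a
hypothesis with a free exponent `e`, so that the improved bound for `c = 0` can be inserted;
replacing `b` by `b₀` in the exponential gives uniformity in `b`. -/
theorem exists_norm_fourierInv_radialSymbol_le [Nontrivial V] {p : V → ℝ} (hp : ContDiff ℝ ∞ p)
    {d : ℕ} (hd : ∀ R : ℝ, 0 < R → ∀ ξ, p (R • ξ) = R ^ d * p ξ) {a b₀ c e : ℝ} (ha : 0 < a)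
    (hb₀ : 0 < b₀) (he : 0 < e + d / 2) :
    ∃ θ C : ℝ, 0 < θ ∧ 0 ≤ C ∧ ∀ b A : ℝ, b₀ ≤ b → 0 ≤ A →
      (∀ v : ℝ, 0 < v → |taylorWeight a b (Module.finrank ℝ V + 2) c v| ≤
        A * (v ^ (e - (Module.finrank ℝ V + 2 + 1 : ℕ)) * Real.exp (-(b / 2) * v ^ a))) →
      ∀ x, ‖𝓕⁻ (radialSymbol p a b c) x‖ ≤ A * C * (1 + ‖x‖) ^ (-(Module.finrank ℝ V + θ)) := by
  set D := Module.finrank ℝ V with hD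
  obtain ⟨C, hC, hB⟩ := exists_norm_fourierInv_le
    (contDiff_rieszSymbol hp (m := D + 1) (K := D + 2) rfl)
    (hasCompactSupport_rieszSymbol p (by omega))
  -- The cap `1` respects the decay of order `D + 1` of the Bochner-Riesz kernel; `θ ≤ e + d/2`
  -- keeps the second term of `G` integrable at `0`.
  set θ := min 1 (e + d / 2) with hθ
  have hθ0 : 0 < θ := lt_min one_pos he
  have hθ1 : θ ≤ 1 := min_le_left _ _
  have hθ2 : θ ≤ e + d / 2 := min_le_right _ _
  set q : ℝ := D + θ with hq
  have hq0 : 0 ≤ q := by positivity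
  set G : ℝ → ℝ := fun v => v ^ (e + (d + D : ℕ) / 2 - 1) * Real.exp (-(b₀ / 2) * v ^ a) +
    v ^ (e + (d + D : ℕ) / 2 - 1 - q / 2) * Real.exp (-(b₀ / 2) * v ^ a) with hG
  have hGi : IntegrableOn G (Ioi 0) := by
    have hD0 : (0 : ℝ) ≤ D := by positivity
    refine (integrableOn_rpow_mul_exp_neg_mul_rpow ?_ ha (half_pos hb₀)).add
      (integrableOn_rpow_mul_exp_neg_mul_rpow ?_ ha (half_pos hb₀))
    · push_cast; linarith
    · rw [hq]; push_cast; linarith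
  refine ⟨θ, C * ∫ v in Ioi 0, G v, hθ0, mul_nonneg hC (setIntegral_nonneg measurableSet_Ioi
    fun v hv => ?_), fun b A hb hA h x => ?_⟩
  · have : 0 < v := hv
    positivity
  have hb0 : 0 < b := hb₀.trans_le hb
  have hw : IntegrableOn (rieszDensity a b c (D + 2) (d + D)) (Ioi 0) := by
    refine integrableOn_rieszDensity ha hb0 ?_ h
    push_cast
    have : (0 : ℝ) ≤ D := by positivity
    linarith
  rw [fourierInv_radialSymbol_eq hp hd ha hb0 (by omega) hw]
  have hpt : ∀ v ∈ Ioi (0 : ℝ), ‖(rieszDensity a b c (D + 2) (d + D) v : ℂ) *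
      𝓕⁻ (rieszSymbol p (D + 2)) (√v • x)‖ ≤ A * C * (1 + ‖x‖) ^ (-q) * G v := by
    intro v hv
    have hv : 0 < v := hv
    rw [norm_mul, Complex.norm_real, Real.norm_eq_abs]
    have h1 := abs_rieszDensity_le (m := d + D) hv (h v hv)
    have h2 : ‖𝓕⁻ (rieszSymbol p (D + 2)) (√v • x)‖ ≤
        C * ((1 + v ^ (-(q / 2))) * (1 + ‖x‖) ^ (-q)) := by
      refine (hB _).trans ?_
      rw [norm_smul, Real.norm_of_nonneg (Real.sqrt_nonneg v)]
      gcongr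
      refine le_trans ?_ (one_add_mul_rpow_neg_le hv (norm_nonneg x) hq0)
      refine Real.rpow_le_rpow_of_exponent_le ?_ ?_
      · have : 0 ≤ √v * ‖x‖ := by positivity
        linarith
      · rw [hq]; linarith
    have h3 : Real.exp (-(b / 2) * v ^ a) ≤ Real.exp (-(b₀ / 2) * v ^ a) := by
      gcongr
    calc _ ≤ (A * (v ^ (e + (d + D : ℕ) / 2 - 1) * Real.exp (-(b₀ / 2) * v ^ a))) *
          (C * ((1 + v ^ (-(q / 2))) * (1 + ‖x‖) ^ (-q))) := by
          refine mul_le_mul (h1.trans ?_) h2 (norm_nonneg _) (by positivity)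
          gcongr
      _ = _ := by
          rw [hG]
          simp only
          rw [sub_eq_add_neg _ (q / 2), Real.rpow_add hv _ (-(q / 2))]
          ring
  calc _ ≤ ∫ v in Ioi 0, A * C * (1 + ‖x‖) ^ (-q) * G v := by
        refine norm_integral_le_of_norm_le (hGi.const_mul _) ?_
        filter_upwards [ae_restrict_mem measurableSet_Ioi] with v hv using hpt v hv
    _ = _ := by rw [integral_const_mul]; ring

/-! ### Symmetric differences on the Fourier side -/

lemma contDiffAt_sinc (x : ℝ) : ContDiffAt ℝ ω Real.sinc x := by
  by_cases hx : x = 0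
  · subst hx
    obtain ⟨q, hq⟩ := (Real.contDiff_sin (n := ω)).contDiffAt.analyticAt (x := (0 : ℝ))
    rw [Real.sinc_eq_dslope]
    exact (hq.has_fpower_series_dslope_fslope).analyticAt.contDiffAt
  · have h : Real.sinc =ᶠ[nhds x] fun x => Real.sin x / x := by
      filter_upwards [isOpen_ne.mem_nhds hx] with y hy using Real.sinc_of_ne_zero hy
    exact (Real.contDiff_sin.contDiffAt.div contDiffAt_id hx).congr_of_eventuallyEq h

lemma mul_sinc (x : ℝ) : x * Real.sinc x = Real.sin x := by
  by_cases hx : x = 0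
  · simp [hx]
  · rw [Real.sinc_of_ne_zero hx, mul_div_cancel₀ _ hx]

lemma sinc_ne_zero {x : ℝ} (hx : |x| < Real.pi) : Real.sinc x ≠ 0 := by
  by_cases h0 : x = 0
  · simp [h0]
  · rw [Real.sinc_of_ne_zero h0]
    rw [abs_lt] at hx
    refine div_ne_zero (fun h => h0 ?_) h0
    exact (Real.sin_eq_zero_iff_of_lt_of_lt hx.1 hx.2).1 h

variable {n : ℕ}

/-- The Fourier multiplier of the symmetric difference `Δ_h`. -/
noncomputable def diffSymbol (h ξ : EuclideanSpace ℝ (Fin n)) : ℂ :=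
  Complex.exp ((2 * Real.pi * inner ℝ ξ ((1 / 2 : ℝ) • h) : ℝ) * Complex.I) -
    Complex.exp ((2 * Real.pi * inner ℝ ξ (-((1 / 2 : ℝ) • h)) : ℝ) * Complex.I)

lemma diffSymbol_eq (h ξ : EuclideanSpace ℝ (Fin n)) :
    diffSymbol h ξ = 2 * Complex.I * (Real.sin (Real.pi * inner ℝ ξ h) : ℝ) := by
  rw [diffSymbol, inner_neg_right, real_inner_smul_right, Complex.ofReal_sin, Complex.sin]
  have e1 : ((2 * Real.pi * (1 / 2 * inner ℝ ξ h) : ℝ) : ℂ)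
    = ((Real.pi * inner ℝ ξ h : ℝ) : ℂ) := by congr 1; ring
  have e2 : ((2 * Real.pi * -(1 / 2 * inner ℝ ξ h) : ℝ) : ℂ)
    = -((Real.pi * inner ℝ ξ h : ℝ) : ℂ) := by rw [← Complex.ofReal_neg]; congr 1; ring
  rw [e1, e2]
  have := Complex.I_mul_I
  linear_combination (Complex.exp (((Real.pi * inner ℝ ξ h : ℝ) : ℂ) * Complex.I) -
    Complex.exp (-((Real.pi * inner ℝ ξ h : ℝ) : ℂ) * Complex.I)) * this

lemma contDiff_diffSymbol (h : EuclideanSpace ℝ (Fin n)) : ContDiff ℝ ∞ (diffSymbol h) := by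
  rw [show diffSymbol h = fun ξ => 2 * Complex.I * (Real.sin (Real.pi * inner ℝ ξ h) : ℝ) from
    funext (diffSymbol_eq h)]
  exact contDiff_const.mul (Complex.ofRealCLM.contDiff.comp
    (Real.contDiff_sin.comp (contDiff_const.mul (contDiff_id.inner ℝ contDiff_const))))

/-- Powers of a coordinate may be divided by the same power of the multiplier of a difference,
on symbols supported in the unit ball. -/
lemma exists_diffSymbol_pow_mul_eq {m : ℕ} {g : EuclideanSpace ℝ (Fin n) → ℂ} (hg : ContDiff ℝ m g)
    (hc : HasCompactSupport g) (hg0 : ∀ ξ, 1 ≤ ‖ξ‖ → g ξ = 0) {h : EuclideanSpace ℝ (Fin n)}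
    (hh : ‖h‖ ≤ 1 / 2) (r : ℕ) :
    ∃ b : EuclideanSpace ℝ (Fin n) → ℂ, ContDiff ℝ m b ∧ HasCompactSupport b ∧
      ∀ ξ, ((inner ℝ ξ h : ℝ) : ℂ) ^ r * g ξ = diffSymbol h ξ ^ r * b ξ := by
  refine ⟨fun ξ => (((Real.sinc (Real.pi * inner ℝ ξ h))⁻¹ : ℝ) : ℂ) ^ r *
    (2 * Real.pi * Complex.I)⁻¹ ^ r * g ξ, ?_, hc.mul_left, fun ξ => ?_⟩
  · rw [contDiff_iff_contDiffAt]
    intro ξ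
    -- For `|ξ| < 2` and `|h| ≤ 1/2` the argument `π ξ·h` stays inside `(-π, π)`, where `sinc` has
    -- no zero; for `|ξ| ≥ 2` the symbol vanishes near `ξ`.
    by_cases hξ : ‖ξ‖ < 2
    · refine ContDiffAt.mul (ContDiffAt.mul (ContDiffAt.pow ?_ r) contDiffAt_const) hg.contDiffAt
      refine Complex.ofRealCLM.contDiff.contDiffAt.comp ξ (ContDiffAt.inv ?_ ?_)
      · refine ((contDiffAt_sinc _).of_le le_top).comp ξ ?_
        exact contDiffAt_const.mul (contDiffAt_id.inner ℝ contDiffAt_const)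
      · apply sinc_ne_zero
        rw [abs_mul, abs_of_pos Real.pi_pos]
        have h1 := abs_real_inner_le_norm ξ h
        have h2 : ‖ξ‖ * ‖h‖ < 1 := by nlinarith [norm_nonneg ξ, norm_nonneg h]
        nlinarith [Real.pi_pos]
    · refine (contDiffAt_const (c := (0 : ℂ))).congr_of_eventuallyEq ?_
      have : {ξ : EuclideanSpace ℝ (Fin n) | 1 < ‖ξ‖} ∈ nhds ξ :=
        (isOpen_lt continuous_const continuous_norm).mem_nhds (by
          show 1 < ‖ξ‖
          linarith)
      filter_upwards [this] with y hy
      rw [hg0 y (le_of_lt hy), mul_zero]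
  · by_cases hξ : 1 ≤ ‖ξ‖
    · simp [hg0 ξ hξ]
    have h3 : Real.sinc (Real.pi * inner ℝ ξ h) ≠ 0 := by
      apply sinc_ne_zero
      rw [abs_mul, abs_of_pos Real.pi_pos]
      have h1 := abs_real_inner_le_norm ξ h
      have h2 : ‖ξ‖ * ‖h‖ < 1 := by nlinarith [norm_nonneg ξ, norm_nonneg h]
      nlinarith [Real.pi_pos]
    rw [diffSymbol_eq, ← mul_sinc, ← mul_assoc, ← mul_assoc, ← mul_pow, ← mul_pow]
    congr 2
    have h4 : ((Real.sinc (Real.pi * inner ℝ ξ h) : ℝ) : ℂ) ≠ 0 := by exact_mod_cast h3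
    have h5 : (Real.pi : ℂ) ≠ 0 := by exact_mod_cast Real.pi_ne_zero
    push_cast
    field_simp

lemma fourierInv_diffSymbol_mul {b : EuclideanSpace ℝ (Fin n) → ℂ} (hb : Integrable b)
    (h y : EuclideanSpace ℝ (Fin n)) :
    𝓕⁻ (fun ξ => diffSymbol h ξ * b ξ) y
      = 𝓕⁻ b (y + (1 / 2 : ℝ) • h) - 𝓕⁻ b (y - (1 / 2 : ℝ) • h) := by
  have hi : ∀ w : EuclideanSpace ℝ (Fin n), Integrable (fun ξ =>
      Complex.exp (↑(2 * Real.pi * inner ℝ ξ w) * Complex.I) • b ξ) := by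
    intro w
    have := (Real.fourierIntegral_convergent_iff (μ := volume) (f := b) (-w)).2 hb
    refine this.congr (ae_of_all _ fun ξ => ?_)
    simp only [inner_neg_right, neg_neg, Circle.smul_def, Real.fourierChar_apply]
  rw [Real.fourierInv_eq', Real.fourierInv_eq', Real.fourierInv_eq', ← integral_sub (hi _) (hi _)]
  refine integral_congr_ae (ae_of_all _ fun ξ => ?_)
  simp only [smul_eq_mul, diffSymbol, sub_eq_add_neg y, inner_add_right, mul_add, Complex.ofReal_add,
    add_mul, Complex.exp_add]
  ring

lemma continuous_centralDiff {f : EuclideanSpace ℝ (Fin n) → ℝ} (hf : Continuous f)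
    (h : EuclideanSpace ℝ (Fin n)) : Continuous (centralDiff h f) := by
  unfold centralDiff
  fun_prop

lemma abs_centralDiff_le {f : EuclideanSpace ℝ (Fin n) → ℝ} {F : ℝ} (hF : ∀ x, |f x| ≤ F)
    (h x : EuclideanSpace ℝ (Fin n)) : |centralDiff h f x| ≤ 2 * F := by
  have := abs_sub (f (x + (1 / 2 : ℝ) • h)) (f (x - (1 / 2 : ℝ) • h))
  have h1 := hF (x + (1 / 2 : ℝ) • h)
  have h2 := hF (x - (1 / 2 : ℝ) • h)
  unfold centralDiff
  linarith

lemma abs_centralDiff_iterate_le (h : EuclideanSpace ℝ (Fin n)) (r : ℕ) :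
    ∀ {f : EuclideanSpace ℝ (Fin n) → ℝ} {F : ℝ}, (∀ x, |f x| ≤ F) →
      ∀ x, |(centralDiff h)^[r] f x| ≤ 2 ^ r * F := by
  induction r with
  | zero => intro f F hF x; simpa using hF x
  | succ r ih =>
    intro f F hF x
    rw [Function.iterate_succ_apply, pow_succ, mul_assoc]
    exact ih (abs_centralDiff_le hF h) x

lemma integrable_mul_ofReal {g : EuclideanSpace ℝ (Fin n) → ℂ} (hg : Integrable g)
    {f : EuclideanSpace ℝ (Fin n) → ℝ} (hf : Continuous f) {F : ℝ} (hF : ∀ x, |f x| ≤ F) :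
    Integrable (fun x => g x * (f x : ℂ)) :=
  hg.mul_bdd (c := F) (Complex.continuous_ofReal.comp hf).aestronglyMeasurable
    (ae_of_all _ fun x => by rw [Complex.norm_real]; exact hF x)

/-- Summation by parts for symmetric differences, on the Fourier side. -/
lemma integral_fourierInv_diffSymbol_pow_mul (h : EuclideanSpace ℝ (Fin n))
    {b : EuclideanSpace ℝ (Fin n) → ℂ}
    (hb : ContDiff ℝ (Module.finrank ℝ (EuclideanSpace ℝ (Fin n)) + 1 : ℕ) b)
    (hc : HasCompactSupport b) (r : ℕ) :
    ∀ {f : EuclideanSpace ℝ (Fin n) → ℝ} {F : ℝ}, Continuous f → (∀ x, |f x| ≤ F) →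
      ∫ y, 𝓕⁻ (fun ξ => diffSymbol h ξ ^ r * b ξ) y * (f y : ℂ)
        = (-1) ^ r * ∫ y, 𝓕⁻ b y * ((centralDiff h)^[r] f y : ℂ) := by
  induction r with
  | zero => intro f F _ _; simp
  | succ r ih =>
    intro f F hf hF
    set b' : EuclideanSpace ℝ (Fin n) → ℂ := fun ξ => diffSymbol h ξ ^ r * b ξ with hb'
    have hb1 : ContDiff ℝ (Module.finrank ℝ (EuclideanSpace ℝ (Fin n)) + 1 : ℕ) b' :=
      (((contDiff_diffSymbol h).of_le (by exact_mod_cast le_top)).pow r).mul hb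
    have hb2 : HasCompactSupport b' := hc.mul_left
    have hbi : Integrable b' := hb1.continuous.integrable_of_hasCompactSupport hb2
    have hBi : Integrable (𝓕⁻ b') := integrable_fourierInv hb1 hb2
    have e : (fun ξ => diffSymbol h ξ ^ (r + 1) * b ξ) = fun ξ => diffSymbol h ξ * b' ξ := by
      funext ξ; rw [hb', pow_succ]; ring
    set k := (1 / 2 : ℝ) • h with hk
    have i1 : Integrable (fun y => 𝓕⁻ b' (y + k) * (f y : ℂ)) :=
      integrable_mul_ofReal (hBi.comp_add_right k) hf hF
    have i2 : Integrable (fun y => 𝓕⁻ b' (y - k) * (f y : ℂ)) :=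
      integrable_mul_ofReal (hBi.comp_sub_right k) hf hF
    have i3 : Integrable (fun y => 𝓕⁻ b' y * (f (y - k) : ℂ)) :=
      integrable_mul_ofReal (f := fun y => f (y - k)) hBi (by fun_prop) (fun y => hF _)
    have i4 : Integrable (fun y => 𝓕⁻ b' y * (f (y + k) : ℂ)) :=
      integrable_mul_ofReal (f := fun y => f (y + k)) hBi (by fun_prop) (fun y => hF _)
    have s1 := integral_add_right_eq_self (μ := volume)
      (fun y => 𝓕⁻ b' y * (f (y - k) : ℂ)) k
    have s2 := integral_sub_right_eq_self (μ := volume)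
      (fun y => 𝓕⁻ b' y * (f (y + k) : ℂ)) k
    simp only [add_sub_cancel_right, sub_add_cancel] at s1 s2
    rw [e, Function.iterate_succ_apply, pow_succ, mul_comm ((-1 : ℂ) ^ r) (-1), mul_assoc,
      ← ih (continuous_centralDiff hf h) (abs_centralDiff_le hF h)]
    simp only [fourierInv_diffSymbol_mul hbi, sub_mul, ← hk]
    rw [integral_sub i1 i2, s1, s2, ← integral_sub i3 i4, neg_one_mul, ← integral_neg]
    refine integral_congr_ae (ae_of_all _ fun y => ?_)
    simp only [centralDiff, ← hk]
    push_cast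
    ring

/-! ### Bochner-Riesz kernels tested against functions with small differences -/

lemma contDiff_mvPolynomial_eval (P : MvPolynomial (Fin n) ℝ) :
    ContDiff ℝ ∞ (fun ξ : EuclideanSpace ℝ (Fin n) => MvPolynomial.eval (fun j => ξ j) P) := by
  induction P using MvPolynomial.induction_on with
  | C a => simpa using contDiff_const
  | add p q hp hq => simpa using hp.add hq
  | mul_X p j hp =>
    simp only [map_mul, MvPolynomial.eval_X]
    exact hp.mul (by fun_prop)

/-- Pigeonhole: a monomial of degree `nr + 1` in the `n` quantities `ξ_j^2` contains one of them to
a power at least `r + 1`. -/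
lemma exists_norm_pow_eq_sum (n r : ℕ) :
    ∃ P : Fin n → EuclideanSpace ℝ (Fin n) → ℝ, (∀ j, ContDiff ℝ ∞ (P j)) ∧
      ∀ ξ, ‖ξ‖ ^ (2 * (n * r + 1)) = ∑ j, P j ξ * (ξ j ^ 2) ^ (r + 1) := by
  have h := Ideal.sum_pow_mem_span_pow Finset.univ
    (fun j : Fin n => (MvPolynomial.X j ^ 2 : MvPolynomial (Fin n) ℝ)) r
  rw [Finset.coe_univ, image_univ, Ideal.mem_span_range_iff_exists_fun, Finset.card_univ,
    Fintype.card_fin] at h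
  obtain ⟨c, hc⟩ := h
  refine ⟨fun j ξ => MvPolynomial.eval (fun j => ξ j) (c j),
    fun j => contDiff_mvPolynomial_eval (c j), fun ξ => ?_⟩
  have := congrArg (MvPolynomial.eval (fun j => ξ j)) hc
  simp only [map_sum, map_mul, map_pow, MvPolynomial.eval_X] at this
  rw [this, pow_mul, EuclideanSpace.real_norm_sq_eq]

/-- The factor `|ξ|^{2(nr+1)}` splits the symbol into `n` pieces, each divisible by the `r`-th power
of the multiplier of a difference in one coordinate direction. The quotients keep `D + 1`
derivatives, so their transforms are integrable after the differences have moved to `f`. -/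
theorem exists_norm_integral_fourierInv_rieszSymbol_mul_le
    {p p₀ : EuclideanSpace ℝ (Fin n) → ℝ} (hp₀ : ContDiff ℝ ∞ p₀) (r : ℕ)
    (hp : ∀ ξ, p ξ = p₀ ξ * ‖ξ‖ ^ (2 * (n * r + 1))) :
    ∃ C : ℝ, 0 ≤ C ∧ ∀ (f : EuclideanSpace ℝ (Fin n) → ℝ) (F M : ℝ), Continuous f →
      (∀ x, |f x| ≤ F) →
      (∀ h : EuclideanSpace ℝ (Fin n), ‖h‖ = 1 / 2 → ∀ x, |(centralDiff h)^[r] f x| ≤ M) →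
      ‖∫ y, 𝓕⁻ (rieszSymbol p (Module.finrank ℝ (EuclideanSpace ℝ (Fin n)) + 2)) y * (f y : ℂ)‖
        ≤ C * M := by
  set D := Module.finrank ℝ (EuclideanSpace ℝ (Fin n)) with hD
  obtain ⟨P, hP, hsum⟩ := exists_norm_pow_eq_sum n r
  set H : Fin n → EuclideanSpace ℝ (Fin n) :=
    fun j => (1 / 2 : ℝ) • EuclideanSpace.single j (1 : ℝ) with hH
  have hHn : ∀ j, ‖H j‖ = 1 / 2 := fun j => by simp [hH, norm_smul]
  have hHi : ∀ j ξ, inner ℝ ξ (H j) = ξ j / 2 := fun j ξ => by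
    simp only [hH, real_inner_smul_right, EuclideanSpace.inner_single_right]
    simp
    ring
  -- From `(ξ_j^2)^(r+1) = ξ_j^r ξ_j^(r+2)` the factor `ξ_j^r` is set aside; `2 ^ r` compensates for
  -- `ξ·H j = ξ_j / 2`.
  set q : Fin n → EuclideanSpace ℝ (Fin n) → ℝ :=
    fun j ξ => 2 ^ r * p₀ ξ * P j ξ * ξ j ^ (r + 2) with hq
  have hqs : ∀ j, ContDiff ℝ ∞ (q j) := fun j =>
    ((contDiff_const.mul hp₀).mul (hP j)).mul (by fun_prop)
  choose b hb1 hb2 hb3 using fun j => exists_diffSymbol_pow_mul_eq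
    (contDiff_rieszSymbol (hqs j) (m := D + 1) (K := D + 2) rfl)
    (hasCompactSupport_rieszSymbol (q j) (by omega))
    (fun ξ hξ => rieszSymbol_eq_zero (q j) (by omega) hξ) (hHn j).le r
  have hdec : ∀ ξ, rieszSymbol p (D + 2) ξ = ∑ j, diffSymbol (H j) ξ ^ r * b j ξ := by
    intro ξ
    simp only [← hb3, hHi]
    rw [rieszSymbol, hp, hsum, Finset.mul_sum, Finset.sum_mul, Complex.ofReal_sum]
    refine Finset.sum_congr rfl fun j _ => ?_
    rw [rieszSymbol, ← Complex.ofReal_pow, ← Complex.ofReal_mul]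
    congr 1
    simp only [hq]
    rw [div_pow]
    field_simp
    ring
  have hgi1 : ∀ j, ContDiff ℝ (D + 1 : ℕ) (fun ξ => diffSymbol (H j) ξ ^ r * b j ξ) := fun j =>
    (((contDiff_diffSymbol (H j)).of_le (by exact_mod_cast le_top)).pow r).mul (hb1 j)
  have hgi2 : ∀ j, HasCompactSupport (fun ξ => diffSymbol (H j) ξ ^ r * b j ξ) := fun j =>
    (hb2 j).mul_left
  have hF : ∀ y, 𝓕⁻ (rieszSymbol p (D + 2)) y
      = ∑ j, 𝓕⁻ (fun ξ => diffSymbol (H j) ξ ^ r * b j ξ) y := by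
    intro y
    simp only [Real.fourierInv_eq']
    rw [← integral_finsetSum]
    · refine integral_congr_ae (ae_of_all _ fun ξ => ?_)
      simp only [hdec, Finset.smul_sum]
    · intro j _
      have h1 := (hgi1 j).continuous.integrable_of_hasCompactSupport (hgi2 j) (μ := volume)
      have := (Real.fourierIntegral_convergent_iff (μ := volume) (-y)).2 h1
      refine this.congr (ae_of_all _ fun ξ => ?_)
      simp only [inner_neg_right, neg_neg, Circle.smul_def, Real.fourierChar_apply]
  refine ⟨∑ j, ∫ y, ‖𝓕⁻ (b j) y‖, Finset.sum_nonneg fun j _ => integral_nonneg fun y =>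
    norm_nonneg _, fun f F M hf hfF hM => ?_⟩
  simp only [hF, Finset.sum_mul]
  rw [integral_finsetSum]
  · refine norm_sum_le_of_le _ fun j _ => ?_
    rw [integral_fourierInv_diffSymbol_pow_mul (H j) (hb1 j) (hb2 j) r hf hfF, norm_mul, norm_pow,
      norm_neg, norm_one, one_pow, one_mul, ← integral_mul_const]
    refine norm_integral_le_of_norm_le ((integrable_fourierInv (hb1 j) (hb2 j)).norm.mul_const M)
      (ae_of_all _ fun y => ?_)
    rw [norm_mul, Complex.norm_real, Real.norm_eq_abs]
    gcongr
    exact hM (H j) (hHn j) y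
  · intro j _
    exact integrable_mul_ofReal (integrable_fourierInv (hgi1 j) (hgi2 j)) hf hfF

/-! ### The scaled estimate for radial symbols -/

lemma centralDiff_iterate_comp_sub_smul (c : ℝ) (x h : EuclideanSpace ℝ (Fin n)) (r : ℕ) :
    ∀ f : EuclideanSpace ℝ (Fin n) → ℝ, (centralDiff h)^[r] (fun y => f (x - c • y))
      = fun y => (centralDiff (-(c • h)))^[r] f (x - c • y) := by
  induction r with
  | zero => intro f; rfl
  | succ r ih =>
    intro f
    rw [Function.iterate_succ_apply, Function.iterate_succ_apply, ← ih]
    congr 1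
    funext y
    simp only [centralDiff]
    congr 2 <;> module

lemma integral_comp_smul_sub_mul {g : EuclideanSpace ℝ (Fin n) → ℂ}
    {f : EuclideanSpace ℝ (Fin n) → ℝ} {R : ℝ} (hR : 0 < R) (x : EuclideanSpace ℝ (Fin n)) :
    ∫ z, g (R • (x - z)) * (f z : ℂ)
      = ((R ^ Module.finrank ℝ (EuclideanSpace ℝ (Fin n)))⁻¹ : ℝ) *
        ∫ y, g y * (f (x - R⁻¹ • y) : ℂ) := by
  have h1 := integral_sub_left_eq_self (μ := volume)
    (fun w : EuclideanSpace ℝ (Fin n) => g (R • w) * (f (x - w) : ℂ)) x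
  simp only [sub_sub_cancel] at h1
  have h2 := Measure.integral_comp_smul (volume : Measure (EuclideanSpace ℝ (Fin n)))
    (fun y => g y * (f (x - R⁻¹ • y) : ℂ)) R
  simp only [smul_smul, inv_mul_cancel₀ hR.ne', one_smul] at h2
  rw [h1, h2, abs_of_pos (by positivity), Complex.real_smul]

/-- At scale `√v` the kernel sees differences of `f` with step `1/(2√v)`, hence a gain `v^{-s/2}`
over the density. -/
theorem exists_norm_integral_fourierInv_radialSymbol_mul_le [Nontrivial (EuclideanSpace ℝ (Fin n))]
    {p p₀ : EuclideanSpace ℝ (Fin n) → ℝ} (hp₀ : ContDiff ℝ ∞ p₀) (r : ℕ)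
    (hpp : ∀ ξ, p ξ = p₀ ξ * ‖ξ‖ ^ (2 * (n * r + 1))) {d : ℕ}
    (hd : ∀ R : ℝ, 0 < R → ∀ ξ, p (R • ξ) = R ^ d * p ξ) {a c s : ℝ} (ha : 0 < a) (hs : 0 < s)
    (hcs : s < 2 * c + d) :
    ∃ C : ℝ, 0 ≤ C ∧ ∀ (b : ℝ) (f : EuclideanSpace ℝ (Fin n) → ℝ) (F M : ℝ), 0 < b →
      Continuous f → (∀ x, |f x| ≤ F) →
      (∀ h x : EuclideanSpace ℝ (Fin n), |(centralDiff h)^[r] f x| ≤ M * ‖h‖ ^ s) →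
      ∀ x, ‖∫ z, 𝓕⁻ (radialSymbol p a b c) (x - z) * (f z : ℂ)‖
        ≤ C * M * b ^ (-((2 * c + d - s) / (2 * a))) := by
  have hp : ContDiff ℝ ∞ p := by
    rw [show p = fun ξ => p₀ ξ * ‖ξ‖ ^ (2 * (n * r + 1)) from funext hpp]
    simp only [pow_mul]
    exact hp₀.mul ((contDiff_norm_sq ℝ).pow _)
  set D := Module.finrank ℝ (EuclideanSpace ℝ (Fin n)) with hD
  obtain ⟨C₁, hC₁, hdiff⟩ := exists_norm_integral_fourierInv_rieszSymbol_mul_le hp₀ r hpp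
  obtain ⟨A, hA, hder⟩ := exists_abs_radialDeriv_le ha (D + 2 + 1) c
  rw [← hD] at hdiff
  set B := 𝓕⁻ (rieszSymbol p (D + 2)) with hB
  have hBc : Continuous B := continuous_fourierInv (integrable_rieszSymbol hp (by omega))
  have hBi : Integrable B := integrable_fourierInv
    (contDiff_rieszSymbol hp (m := D + 1) (K := D + 2) rfl)
    (hasCompactSupport_rieszSymbol p (by omega))
  -- The final integrand is `v^(Q-1) exp(-(b/2) v^a)`; `Q > 0` is exactly `s < 2c + d`.
  set Q := c + d / 2 - s / 2 with hQ
  have hQ0 : 0 < Q := by rw [hQ]; linarith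
  have hG0 : 0 < Real.Gamma (Q / a) := Real.Gamma_pos_of_pos (by positivity)
  refine ⟨A * C₁ * ((1 / 2) ^ (-(Q / a)) * (1 / a) * Real.Gamma (Q / a)), by positivity,
    fun b f F M hb hf hfF hM x => ?_⟩
  have hM0 : 0 ≤ M := by
    obtain ⟨h, hh⟩ := exists_norm_eq (EuclideanSpace ℝ (Fin n)) zero_le_one
    have := (abs_nonneg _).trans (hM h 0)
    rwa [hh, Real.one_rpow, mul_one] at this
  have hF0 : 0 ≤ F := (abs_nonneg _).trans (hfF 0)
  have hD0 : (0 : ℝ) ≤ D := by positivity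
  have hwt : ∀ v : ℝ, 0 < v → |taylorWeight a b (D + 2) c v| ≤
      A * (v ^ (c - (D + 2 + 1 : ℕ)) * Real.exp (-(b / 2) * v ^ a)) := fun v hv =>
    (abs_taylorWeight_le a b (D + 2) c v).trans (hder b v hb hv)
  have hρ : IntegrableOn (rieszDensity a b c (D + 2) (d + D)) (Ioi 0) :=
    integrableOn_rieszDensity ha hb (by push_cast; linarith) hwt
  have hρd : IntegrableOn (rieszDensity a b c (D + 2) d) (Ioi 0) :=
    integrableOn_rieszDensity ha hb (by linarith) hwt
  -- The factor `√v ^ D` will cancel the Jacobian of `y = √v (x - z)`.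
  have hsplit : ∀ v : ℝ, rieszDensity a b c (D + 2) (d + D) v
      = rieszDensity a b c (D + 2) d v * √v ^ D := fun v => by
    rw [rieszDensity, rieszDensity, ← add_assoc, pow_add]; ring
  have hswap : Integrable (fun q : EuclideanSpace ℝ (Fin n) × ℝ =>
      ((rieszDensity a b c (D + 2) (d + D) q.2 : ℂ) * B (√q.2 • (x - q.1))) * (f q.1 : ℂ))
      ((volume : Measure (EuclideanSpace ℝ (Fin n))).prod (volume.restrict (Ioi (0 : ℝ)))) := by
    have hmeas : AEStronglyMeasurable (fun q : EuclideanSpace ℝ (Fin n) × ℝ =>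
      ((rieszDensity a b c (D + 2) (d + D) q.2 : ℂ) * B (√q.2 • (x - q.1))) * (f q.1 : ℂ))
      ((volume : Measure (EuclideanSpace ℝ (Fin n))).prod (volume.restrict (Ioi (0 : ℝ)))) := by
      have h1 := ((continuousOn_rieszDensity a b c (D + 2) (d + D)).aestronglyMeasurable
        (μ := volume) measurableSet_Ioi)
      have h2 : Continuous (fun q : EuclideanSpace ℝ (Fin n) × ℝ => B (√q.2 • (x - q.1))) := by
        fun_prop
      have h3 : Continuous (fun q : EuclideanSpace ℝ (Fin n) × ℝ => (f q.1 : ℂ)) := by fun_prop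
      exact ((Complex.continuous_ofReal.comp_aestronglyMeasurable h1.comp_snd).mul
        h2.aestronglyMeasurable).mul h3.aestronglyMeasurable
    have hdom : Integrable (fun q : EuclideanSpace ℝ (Fin n) × ℝ =>
        (rieszDensity a b c (D + 2) (d + D) q.2 : ℂ) * B (√q.2 • (x - q.1)))
        ((volume : Measure (EuclideanSpace ℝ (Fin n))).prod (volume.restrict (Ioi (0 : ℝ)))) := by
      have hmeas' : AEStronglyMeasurable (fun q : EuclideanSpace ℝ (Fin n) × ℝ =>
        (rieszDensity a b c (D + 2) (d + D) q.2 : ℂ) * B (√q.2 • (x - q.1)))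
        ((volume : Measure (EuclideanSpace ℝ (Fin n))).prod (volume.restrict (Ioi (0 : ℝ)))) := by
        have h1 := ((continuousOn_rieszDensity a b c (D + 2) (d + D)).aestronglyMeasurable
          (μ := volume) measurableSet_Ioi)
        have h2 : Continuous (fun q : EuclideanSpace ℝ (Fin n) × ℝ => B (√q.2 • (x - q.1))) := by
          fun_prop
        exact (Complex.continuous_ofReal.comp_aestronglyMeasurable h1.comp_snd).mul
          h2.aestronglyMeasurable
      rw [integrable_prod_iff' hmeas']
      constructor
      · filter_upwards [ae_restrict_mem measurableSet_Ioi] with v hv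
        exact ((hBi.comp_smul (Real.sqrt_pos.2 hv).ne').comp_sub_left x).const_mul _
      · refine ((hρd.norm).mul_const (∫ y, ‖B y‖)).congr ?_
        filter_upwards [ae_restrict_mem measurableSet_Ioi] with v hv
        have hv : 0 < √v := Real.sqrt_pos.2 hv
        simp only [norm_mul, Complex.norm_real]
        have h1 := integral_sub_left_eq_self (μ := volume)
          (fun w : EuclideanSpace ℝ (Fin n) => ‖B (√v • w)‖) x
        have h2 := Measure.integral_comp_smul (volume : Measure (EuclideanSpace ℝ (Fin n)))
          (fun y => ‖B y‖) (√v)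
        rw [integral_const_mul, h1, h2, hsplit, norm_mul, abs_of_pos (by positivity), smul_eq_mul,
          Real.norm_of_nonneg (by positivity : 0 ≤ √v ^ D), ← hD]
        field_simp
    refine (hdom.norm.mul_const F).mono' hmeas (ae_of_all _ fun q => ?_)
    rw [norm_mul _ (f q.1 : ℂ), Complex.norm_real]
    gcongr
    exact hfF _
  have hrep : ∫ z, 𝓕⁻ (radialSymbol p a b c) (x - z) * (f z : ℂ) = ∫ v in Ioi (0 : ℝ),
      (rieszDensity a b c (D + 2) d v : ℂ) * ∫ y, B y * (f (x - (√v)⁻¹ • y) : ℂ) := by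
    simp only [fourierInv_radialSymbol_eq hp hd ha hb (show D + 2 ≠ 0 by omega) hρ,
      ← integral_mul_const]
    rw [integral_integral_swap hswap]
    refine setIntegral_congr_fun measurableSet_Ioi fun v hv => ?_
    have hv : 0 < √v := Real.sqrt_pos.2 hv
    simp only [mul_assoc]
    rw [integral_const_mul, integral_comp_smul_sub_mul hv, hsplit, ← hD, ← hB]
    push_cast
    have : ((√v : ℝ) : ℂ) ≠ 0 := by exact_mod_cast hv.ne'
    field_simp
  have hpt : ∀ v ∈ Ioi (0 : ℝ), ‖(rieszDensity a b c (D + 2) d v : ℂ) *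
      ∫ y, B y * (f (x - (√v)⁻¹ • y) : ℂ)‖
      ≤ A * C₁ * M * (v ^ (Q - 1) * Real.exp (-(b / 2) * v ^ a)) := by
    intro v hv
    have hv : 0 < v := hv
    have hsv : 0 < √v := Real.sqrt_pos.2 hv
    have h1 := hdiff (fun y => f (x - (√v)⁻¹ • y)) F (M * v ^ (-(s / 2))) (by fun_prop)
      (fun y => hfF _) (fun h hh y => by
        rw [centralDiff_iterate_comp_sub_smul]
        refine (hM _ _).trans ?_
        gcongr
        rw [norm_neg, norm_smul, hh, norm_inv, Real.norm_of_nonneg hsv.le]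
        calc ((√v)⁻¹ * (1 / 2)) ^ s ≤ ((√v)⁻¹) ^ s := by
              gcongr
              have : 0 ≤ (√v)⁻¹ := by positivity
              linarith
          _ = _ := by
              rw [Real.sqrt_eq_rpow, ← Real.rpow_neg hv.le, ← Real.rpow_mul hv.le]
              ring_nf)
    rw [norm_mul, Complex.norm_real, Real.norm_eq_abs]
    calc _ ≤ (A * (v ^ (c + d / 2 - 1) * Real.exp (-(b / 2) * v ^ a))) *
          (C₁ * (M * v ^ (-(s / 2)))) := by
          refine mul_le_mul (abs_rieszDensity_le hv (hwt v hv)) h1 (norm_nonneg _) (by positivity)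
      _ = A * C₁ * M * ((v ^ (c + d / 2 - 1) * v ^ (-(s / 2))) * Real.exp (-(b / 2) * v ^ a)) := by
          ring
      _ = _ := by
          rw [← Real.rpow_add hv, hQ]; ring_nf
  rw [hrep]
  calc _ ≤ ∫ v in Ioi 0, A * C₁ * M * (v ^ (Q - 1) * Real.exp (-(b / 2) * v ^ a)) := by
        refine norm_integral_le_of_norm_le ((integrableOn_rpow_mul_exp_neg_mul_rpow (by linarith)
          ha (half_pos hb)).const_mul _) ?_
        filter_upwards [ae_restrict_mem measurableSet_Ioi] with v hv using hpt v hv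
    _ = _ := by
        rw [integral_const_mul, integral_rpow_mul_exp_neg_mul_rpow ha (by linarith) (half_pos hb),
          sub_add_cancel]
        have e : -((2 * c + d - s) / (2 * a)) = -(Q / a) := by
          rw [hQ]; field_simp
        rw [e, neg_div, show b / 2 = b * (1 / 2) by ring,
          Real.mul_rpow hb.le (by norm_num)]
        ring

/-! ### Families closed under partial derivatives in space-time -/

/-- The linear form `(y, τ) ↦ ∑ j, y j * G j + τ * g` on space-time. -/
noncomputable def jet (G : Fin n → ℂ) (g : ℂ) : EuclideanSpace ℝ (Fin n) × ℝ →L[ℝ] ℂ :=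
  ∑ j, ((EuclideanSpace.proj j : EuclideanSpace ℝ (Fin n) →L[ℝ] ℝ).comp
      (ContinuousLinearMap.fst ℝ (EuclideanSpace ℝ (Fin n)) ℝ)).smulRight (G j) +
    (ContinuousLinearMap.snd ℝ (EuclideanSpace ℝ (Fin n)) ℝ).smulRight g

lemma jet_apply (G : Fin n → ℂ) (g : ℂ) (q : EuclideanSpace ℝ (Fin n) × ℝ) :
    jet G g q = ∑ j, (q.1 j : ℂ) * G j + (q.2 : ℂ) * g := by
  simp [jet]

lemma norm_jet_le {G : Fin n → ℂ} {g : ℂ} {B : ℝ} (hG : ∀ j, ‖G j‖ ≤ B) (hg : ‖g‖ ≤ B) :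
    ‖jet G g‖ ≤ (n + 1) * B := by
  have hB : 0 ≤ B := (norm_nonneg g).trans hg
  refine ContinuousLinearMap.opNorm_le_bound _ (by positivity) fun q => ?_
  rw [jet_apply]
  have h1 : ∀ j, ‖(q.1 j : ℂ) * G j‖ ≤ ‖q‖ * B := fun j => by
    rw [norm_mul, Complex.norm_real]
    gcongr
    · exact (PiLp.norm_apply_le q.1 j).trans (norm_fst_le q)
    · exact hG j
  have h2 : ‖(q.2 : ℂ) * g‖ ≤ ‖q‖ * B := by
    rw [norm_mul, Complex.norm_real]
    gcongr
    exact norm_snd_le q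
  calc _ ≤ ∑ _j : Fin n, ‖q‖ * B + ‖q‖ * B :=
        (norm_add_le _ _).trans (add_le_add (norm_sum_le_of_le _ fun j _ => h1 j) h2)
    _ = _ := by simp; ring

lemma mul_jet (z : ℂ) (G : Fin n → ℂ) (g : ℂ) :
    z • jet G g = jet (fun j => G j * z) (g * z) := by
  refine ContinuousLinearMap.ext fun q => ?_
  simp only [FunLike.coe_smul, Pi.smul_apply, jet_apply, smul_eq_mul, mul_add,
    Finset.mul_sum]
  congr 1
  · refine Finset.sum_congr rfl fun j _ => ?_
    ring
  · ring

lemma aestronglyMeasurable_jet {X : Type*} [MeasurableSpace X] {μ : Measure X}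
    {G : Fin n → X → ℂ} {g : X → ℂ} (hG : ∀ j, AEStronglyMeasurable (G j) μ)
    (hg : AEStronglyMeasurable g μ) : AEStronglyMeasurable (fun a => jet (fun j => G j a) (g a)) μ := by
  simp only [jet]
  refine AEStronglyMeasurable.add ?_ ?_
  · refine Finset.aestronglyMeasurable_fun_sum _ fun j _ => ?_
    exact (ContinuousLinearMap.smulRightL ℝ (EuclideanSpace ℝ (Fin n) × ℝ) ℂ
      _).continuous.comp_aestronglyMeasurable (hG j)
  · exact (ContinuousLinearMap.smulRightL ℝ (EuclideanSpace ℝ (Fin n) × ℝ) ℂ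
      _).continuous.comp_aestronglyMeasurable hg

lemma integrable_jet {X : Type*} [MeasurableSpace X] {μ : Measure X}
    {G : Fin n → X → ℂ} {g : X → ℂ} (hG : ∀ j, Integrable (G j) μ)
    (hg : Integrable g μ) : Integrable (fun a => jet (fun j => G j a) (g a)) μ := by
  have hb : Integrable (fun a => (n + 1) * (∑ j, ‖G j a‖ + ‖g a‖)) μ :=
    ((integrable_finsetSum _ fun j _ => (hG j).norm).add hg.norm).const_mul _
  refine hb.mono' (aestronglyMeasurable_jet (fun j => (hG j).1) hg.1) (ae_of_all _ fun a => ?_)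
  refine norm_jet_le (fun j => ?_) ?_
  · have := Finset.single_le_sum (f := fun j => ‖G j a‖) (fun j _ => norm_nonneg _)
      (Finset.mem_univ j)
    have := norm_nonneg (g a)
    linarith
  · have := Finset.sum_nonneg (s := Finset.univ) (f := fun j => ‖G j a‖) (fun j _ => norm_nonneg _)
    linarith

/-- A family of functions of space-time indexed by the number of time derivatives and by a
multi-index of space derivatives, each of which has the next ones as its partial derivatives. -/
def IsJetFamily (U : ℕ → (Fin n → ℕ) → EuclideanSpace ℝ (Fin n) × ℝ → ℂ) : Prop :=
  ∀ i β, ∀ p ∈ (univ ×ˢ Ioi 0 : Set (EuclideanSpace ℝ (Fin n) × ℝ)),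
    HasFDerivAt (U i β) (jet (fun j => U i (β + Pi.single j 1) p) (U (i + 1) β p)) p

lemma isOpen_univ_prod_Ioi :
    IsOpen (univ ×ˢ Ioi 0 : Set (EuclideanSpace ℝ (Fin n) × ℝ)) :=
  isOpen_univ.prod isOpen_Ioi

/-- The derivative of a member is assembled linearly from other members, so regularity bootstraps by
induction on the order, for all indices at once. -/
theorem IsJetFamily.contDiffOn {U : ℕ → (Fin n → ℕ) → EuclideanSpace ℝ (Fin n) × ℝ → ℂ}
    (hU : IsJetFamily U) (i : ℕ) (β : Fin n → ℕ) : ContDiffOn ℝ ∞ (U i β) (univ ×ˢ Ioi 0) := by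
  rw [contDiffOn_infty]
  intro k
  induction k generalizing i β with
  | zero =>
    rw [Nat.cast_zero, contDiffOn_zero]
    exact fun p hp => (hU i β p hp).continuousAt.continuousWithinAt
  | succ k ih =>
    rw [Nat.cast_succ, contDiffOn_succ_iff_fderiv_of_isOpen isOpen_univ_prod_Ioi]
    refine ⟨fun p hp => (hU i β p hp).differentiableAt.differentiableWithinAt, by simp, ?_⟩
    refine ContDiffOn.congr (f := fun p => jet (fun j => U i (β + Pi.single j 1) p)
      (U (i + 1) β p)) ?_ fun p hp => (hU i β p hp).fderiv
    simp only [jet]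
    exact (ContDiffOn.sum fun j _ => contDiffOn_const.smulRight (ih i _)).add
      (contDiffOn_const.smulRight (ih (i + 1) β))

/-- Differentiation under the integral sign. Local domination of every member suffices, because the
derivative of a member is made of finitely many others. -/
theorem isJetFamily_integral {X : Type*} [MeasurableSpace X] {μ : Measure X}
    {Φ : ℕ → (Fin n → ℕ) → EuclideanSpace ℝ (Fin n) × ℝ → X → ℂ}
    (hmeas : ∀ i β, ∀ p ∈ (univ ×ˢ Ioi 0 : Set (EuclideanSpace ℝ (Fin n) × ℝ)),
      AEStronglyMeasurable (Φ i β p) μ)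
    (hbd : ∀ i β, ∀ p ∈ (univ ×ˢ Ioi 0 : Set (EuclideanSpace ℝ (Fin n) × ℝ)),
      ∃ s ∈ nhds p, ∃ bound : X → ℝ, Integrable bound μ ∧ ∀ a, ∀ q ∈ s, ‖Φ i β q a‖ ≤ bound a)
    (hder : ∀ a, IsJetFamily fun i β p => Φ i β p a) :
    IsJetFamily fun i β p => ∫ a, Φ i β p a ∂μ := by
  intro i β p hp
  have hint : ∀ i β, Integrable (Φ i β p) μ := by
    intro i β
    obtain ⟨s, hs, bound, hb, h⟩ := hbd i β p hp
    exact hb.mono' (hmeas i β p hp) (ae_of_all _ fun a => h a p (mem_of_mem_nhds hs))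
  choose s hs bound hb h using fun j => hbd i (β + Pi.single j 1) p hp
  obtain ⟨s', hs', bound', hb', h'⟩ := hbd (i + 1) β p hp
  have hO := isOpen_univ_prod_Ioi.mem_nhds hp
  have hnn : ∀ j a, 0 ≤ bound j a := fun j a =>
    (norm_nonneg _).trans (h j a p (mem_of_mem_nhds (hs j)))
  have hnn' : ∀ a, 0 ≤ bound' a := fun a => (norm_nonneg _).trans (h' a p (mem_of_mem_nhds hs'))
  set S : Set (EuclideanSpace ℝ (Fin n) × ℝ) := ((⋂ j, s j) ∩ s') ∩ (univ ×ˢ Ioi 0) with hS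
  have hSn : S ∈ nhds p :=
    Filter.inter_mem (Filter.inter_mem (Filter.iInter_mem.2 hs) hs') hO
  have key := hasFDerivAt_integral_of_dominated_of_fderiv_le (𝕜 := ℝ) (μ := μ) (s := S)
    (F := Φ i β) (x₀ := p)
    (F' := fun q a => jet (fun j => Φ i (β + Pi.single j 1) q a) (Φ (i + 1) β q a))
    (bound := fun a => (n + 1) * (∑ j, bound j a + bound' a)) hSn ?_ (hint i β) ?_ ?_ ?_ ?_
  · refine key.congr_fderiv ?_
    have hI : Integrable (fun a =>
        jet (fun j => Φ i (β + Pi.single j 1) p a) (Φ (i + 1) β p a)) μ := 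
      integrable_jet (fun j => hint i (β + Pi.single j 1)) (hint (i + 1) β)
    refine ContinuousLinearMap.ext fun q => ?_
    rw [ContinuousLinearMap.integral_apply hI]
    simp only [jet_apply]
    rw [integral_add (integrable_finsetSum _ fun j _ => (hint i _).const_mul _)
      ((hint _ _).const_mul _), integral_finsetSum _ fun j _ => (hint i _).const_mul _]
    simp only [integral_const_mul]
  · filter_upwards [hO] with q hq using hmeas i β q hq
  · exact aestronglyMeasurable_jet (fun j => hmeas i _ p hp) (hmeas (i + 1) β p hp)
  · refine ae_of_all _ fun a q hq => norm_jet_le (fun j => ?_) ?_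
    · refine (h j a q (mem_iInter.1 hq.1.1 j)).trans ?_
      have := Finset.single_le_sum (f := fun j => bound j a) (fun j _ => hnn j a)
        (Finset.mem_univ j)
      have := hnn' a
      linarith
    · refine (h' a q hq.1.2).trans ?_
      have := Finset.sum_nonneg (s := Finset.univ) (f := fun j => bound j a) (fun j _ => hnn j a)
      linarith
  · exact ((integrable_finsetSum _ fun j _ => hb j).add hb').const_mul _
  · exact ae_of_all _ fun a q hq => hder a i β q hq.2

section MixedDerivatives

variable {U : ℕ → (Fin n → ℕ) → EuclideanSpace ℝ (Fin n) × ℝ → ℂ} (hU : IsJetFamily U)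

include hU

lemma IsJetFamily.partialX_eq (i : ℕ) (β : Fin n → ℕ) {t : ℝ} (ht : 0 < t) (j : Fin n) :
    partialX j (fun x => U i β (x, t)) = fun x => U i (β + Pi.single j 1) (x, t) := by
  funext x
  have h1 := HasFDerivAt.comp (𝕜 := ℝ) (f := fun y => (y, t)) x
    (hU i β (x, t) ⟨mem_univ _, ht⟩) (hasFDerivAt_prodMk_left x t)
  rw [partialX]
  refine (h1.hasLineDerivAt (EuclideanSpace.single j 1)).lineDeriv.trans ?_
  simp only [jet_apply, ContinuousLinearMap.comp_apply, ContinuousLinearMap.inl_apply]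
  rw [Finset.sum_eq_single j] <;> simp +contextual

lemma IsJetFamily.partialX_iterate_eq (i m : ℕ) (β : Fin n → ℕ) {t : ℝ} (ht : 0 < t) (j : Fin n) :
    (partialX j)^[m] (fun x => U i β (x, t)) = fun x => U i (β + Pi.single j m) (x, t) := by
  induction m with
  | zero => simp
  | succ m ih =>
    rw [Function.iterate_succ_apply', ih, hU.partialX_eq i _ ht, add_assoc, ← Pi.single_add]

lemma IsJetFamily.multiDeriv_eq (i : ℕ) (β : Fin n → ℕ) {t : ℝ} (ht : 0 < t) :
    multiDeriv β (fun x => U i 0 (x, t)) = fun x => U i β (x, t) := by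
  have h : ∀ l : List (Fin n),
      l.foldr (fun j φ => (partialX j)^[β j] φ) (fun x => U i 0 (x, t))
        = fun x => U i ((l.map fun j => Pi.single j (β j)).sum) (x, t) := by
    intro l
    induction l with
    | nil => simp
    | cons j l ih =>
      rw [List.foldr_cons, ih, hU.partialX_iterate_eq i (β j) _ ht j, List.map_cons, List.sum_cons,
        add_comm]
  rw [multiDeriv, h]
  have e : ((List.finRange n).map fun j => (Pi.single j (β j) : Fin n → ℕ)).sum = β := by
    rw [← List.ofFn_eq_map, List.sum_ofFn, Finset.univ_sum_single]
  rw [e]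

lemma IsJetFamily.iteratedDeriv_eq (i k : ℕ) (β : Fin n → ℕ) (x : EuclideanSpace ℝ (Fin n)) :
    ∀ {t : ℝ}, 0 < t → iteratedDeriv i (fun τ => U k β (x, τ)) t = U (k + i) β (x, t) := by
  induction i with
  | zero => intro t _; simp
  | succ i ih =>
    intro t ht
    have h : iteratedDeriv i (fun τ => U k β (x, τ)) =ᶠ[nhds t] fun τ => U (k + i) β (x, τ) := by
      filter_upwards [lt_mem_nhds ht] with τ hτ using ih hτ
    rw [iteratedDeriv_succ, h.deriv_eq]
    have h1 := HasFDerivAt.comp (𝕜 := ℝ) (f := fun τ => (x, τ)) t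
      (hU (k + i) β (x, t) ⟨mem_univ _, ht⟩) (hasFDerivAt_prodMk_right x t)
    have h2 := h1.hasDerivAt.deriv
    refine h2.trans ?_
    simp [jet_apply, add_assoc]

theorem IsJetFamily.mixedDeriv_eq {u : ℝ → EuclideanSpace ℝ (Fin n) → ℂ}
    (hu : ∀ t, 0 < t → u t = fun x => U 0 0 (x, t)) (i : ℕ) (β : Fin n → ℕ) {t : ℝ} (ht : 0 < t)
    (x : EuclideanSpace ℝ (Fin n)) : mixedDeriv i β u t x = U i β (x, t) := by
  have h : (fun τ => multiDeriv β (u τ) x) =ᶠ[nhds t] fun τ => U 0 β (x, τ) := by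
    filter_upwards [lt_mem_nhds ht] with τ hτ
    rw [hu τ hτ, hU.multiDeriv_eq 0 β hτ]
  rw [mixedDeriv, h.iteratedDeriv_eq, hU.iteratedDeriv_eq i 0 β x ht, zero_add]

end MixedDerivatives

/-! ### The heat kernel and its derivatives -/

/-- The symbol of `∂_t^i ∂_x^β exp (-t (-Δ)^{α/2})`. -/
noncomputable def mixedSymbol (α : ℝ) (i : ℕ) (β : Fin n → ℕ) (t : ℝ)
    (ξ : EuclideanSpace ℝ (Fin n)) : ℂ :=
  (-(((2 * Real.pi * ‖ξ‖) ^ α : ℝ) : ℂ)) ^ i *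
    (∏ j, (2 * Real.pi * Complex.I * (ξ j : ℂ)) ^ β j) * heatSymbol α t ξ

/-- The derivative `∂_t^i ∂_x^β` of the fractional heat kernel. -/
noncomputable def mixedKernel (α : ℝ) (i : ℕ) (β : Fin n → ℕ)
    (p : EuclideanSpace ℝ (Fin n) × ℝ) : ℂ :=
  𝓕⁻ (mixedSymbol α i β p.2) p.1

lemma mixedSymbol_zero (α t : ℝ) :
    mixedSymbol (n := n) α 0 0 t = heatSymbol α t := by
  funext ξ
  simp [mixedSymbol]

lemma continuous_mixedSymbol {α : ℝ} (hα : 0 < α) (i : ℕ) (β : Fin n → ℕ) (t : ℝ) :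
    Continuous (mixedSymbol α i β t) := by
  have h : Continuous fun ξ : EuclideanSpace ℝ (Fin n) => (2 * Real.pi * ‖ξ‖) ^ α :=
    (continuous_const.mul continuous_norm).rpow_const fun _ => Or.inr hα.le
  unfold mixedSymbol heatSymbol
  fun_prop

lemma norm_heatSymbol (α t : ℝ) (ξ : EuclideanSpace ℝ (Fin n)) :
    ‖heatSymbol α t ξ‖ = Real.exp (-t * (2 * Real.pi * ‖ξ‖) ^ α) := by
  rw [heatSymbol, Complex.norm_real, Real.norm_of_nonneg (Real.exp_nonneg _)]

lemma norm_mixedSymbol_anti {α : ℝ} (i : ℕ) (β : Fin n → ℕ) {t₀ t : ℝ} (ht : t₀ ≤ t)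
    (ξ : EuclideanSpace ℝ (Fin n)) :
    ‖mixedSymbol α i β t ξ‖ ≤ ‖mixedSymbol α i β t₀ ξ‖ := by
  rw [mixedSymbol, mixedSymbol, norm_mul, norm_mul _ (heatSymbol α t₀ ξ), norm_heatSymbol,
    norm_heatSymbol]
  gcongr

lemma norm_mixedSymbol_le (α : ℝ) (i : ℕ) (β : Fin n → ℕ) (t : ℝ)
    (ξ : EuclideanSpace ℝ (Fin n)) :
    ‖mixedSymbol α i β t ξ‖ ≤ ((2 * Real.pi * ‖ξ‖) ^ α) ^ i * (2 * Real.pi * ‖ξ‖) ^ (∑ j, β j) *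
      Real.exp (-t * (2 * Real.pi * ‖ξ‖) ^ α) := by
  have h0 : 0 ≤ 2 * Real.pi * ‖ξ‖ := by positivity
  rw [mixedSymbol, norm_mul, norm_mul, norm_heatSymbol, norm_pow, norm_neg, Complex.norm_real,
    Real.norm_of_nonneg (by positivity), norm_prod, ← Finset.prod_pow_eq_pow_sum]
  gcongr with j
  rw [norm_pow]
  gcongr
  simp only [norm_mul, Complex.norm_real, Complex.norm_I, mul_one, RCLike.norm_ofNat,
    Real.norm_of_nonneg Real.pi_pos.le]
  gcongr
  exact PiLp.norm_apply_le ξ j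

lemma integrable_mixedSymbol (hn : 0 < n) {α : ℝ} (hα : 0 < α) (i : ℕ) (β : Fin n → ℕ) {t : ℝ}
    (ht : 0 < t) : Integrable (mixedSymbol α i β t) := by
  have : Nonempty (Fin n) := ⟨⟨0, hn⟩⟩
  set φ : ℝ → ℝ := fun y => ((2 * Real.pi * y) ^ α) ^ i * (2 * Real.pi * y) ^ (∑ j, β j) *
      Real.exp (-t * (2 * Real.pi * y) ^ α) with hφ
  have key : Integrable (fun ξ : EuclideanSpace ℝ (Fin n) => φ ‖ξ‖) := by
    rw [integrable_fun_norm_addHaar]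
    have hπ : (0 : ℝ) < 2 * Real.pi := by positivity
    have hq : (-1 : ℝ) < α * i + (∑ j, β j : ℕ) + (n - 1 : ℕ) := by
      have : (0 : ℝ) ≤ α * i + (∑ j, β j : ℕ) + (n - 1 : ℕ) := by positivity
      linarith
    have h := (integrableOn_rpow_mul_exp_neg_mul_rpow hq hα
      (show 0 < t * (2 * Real.pi) ^ α by positivity)).const_mul
      (((2 * Real.pi) ^ α) ^ i * (2 * Real.pi) ^ (∑ j, β j))
    refine IntegrableOn.congr_fun h (fun y hy => ?_) measurableSet_Ioi
    have hy : 0 < y := hy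
    simp only [hφ, finrank_euclideanSpace, Fintype.card_fin, smul_eq_mul]
    rw [Real.rpow_add hy, Real.rpow_add hy, Real.rpow_mul hy.le, Real.rpow_natCast,
      Real.rpow_natCast, Real.rpow_natCast, Real.mul_rpow hπ.le hy.le, mul_pow, mul_pow]
    ring_nf
  exact key.mono' (continuous_mixedSymbol hα i β t).aestronglyMeasurable
    (ae_of_all _ fun ξ => norm_mixedSymbol_le α i β t ξ)

lemma prod_pow_add_single {M : Type*} [CommMonoid M] (z : Fin n → M) (β : Fin n → ℕ) (j : Fin n) :
    ∏ k, z k ^ (β + Pi.single j 1 : Fin n → ℕ) k = (∏ k, z k ^ β k) * z j := by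
  simp only [Pi.add_apply, pow_add, Finset.prod_mul_distrib]
  congr 1
  rw [Finset.prod_eq_single j] <;> simp +contextual

/-- For fixed `ξ` this is the exponential of a real-linear form in `(x, t)`; differentiating
multiplies it by `2πi ξ_j` or by `-(2π|ξ|)^α`. -/
lemma isJetFamily_exp_mul_mixedSymbol (α : ℝ) (ξ : EuclideanSpace ℝ (Fin n)) :
    IsJetFamily fun i β p =>
      Complex.exp (((2 * Real.pi * inner ℝ ξ p.1 : ℝ) : ℂ) * Complex.I) * mixedSymbol α i β p.2 ξ := by
  intro i β p _
  set A : ℝ := (2 * Real.pi * ‖ξ‖) ^ α with hA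
  have hfun : ∀ (i : ℕ) (β : Fin n → ℕ) (q : EuclideanSpace ℝ (Fin n) × ℝ),
      Complex.exp (((2 * Real.pi * inner ℝ ξ q.1 : ℝ) : ℂ) * Complex.I) * mixedSymbol α i β q.2 ξ
      = Complex.exp (((2 * Real.pi * inner ℝ ξ q.1 : ℝ) : ℂ) * Complex.I - (q.2 * A : ℝ)) *
        ((-(A : ℂ)) ^ i * ∏ j, (2 * Real.pi * Complex.I * (ξ j : ℂ)) ^ β j) := by
    intro i β q
    rw [mixedSymbol, heatSymbol, sub_eq_add_neg, Complex.exp_add, ← hA, Complex.ofReal_exp,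
      neg_mul, Complex.ofReal_neg]
    ring
  have hin : ∀ y : EuclideanSpace ℝ (Fin n), inner ℝ ξ y = ∑ j, ξ j * y j := fun y => by
    rw [PiLp.inner_apply]
    exact Finset.sum_congr rfl fun j _ => by simp [mul_comm]
  simp only [hfun, prod_pow_add_single]
  set c : ℂ := (-(A : ℂ)) ^ i * ∏ j, (2 * Real.pi * Complex.I * (ξ j : ℂ)) ^ β j with hc
  set L : EuclideanSpace ℝ (Fin n) × ℝ →L[ℝ] ℂ :=
    jet (fun j => 2 * Real.pi * Complex.I * (ξ j : ℂ)) (-(A : ℂ)) with hL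
  have hLeq : (fun q : EuclideanSpace ℝ (Fin n) × ℝ =>
      ((2 * Real.pi * inner ℝ ξ q.1 : ℝ) : ℂ) * Complex.I - (q.2 * A : ℝ)) = L := by
    funext q
    rw [hL, jet_apply, hin]
    push_cast
    rw [Finset.mul_sum, Finset.sum_mul, mul_neg, sub_eq_add_neg]
    congr 1
    exact Finset.sum_congr rfl fun j _ => by ring
  have hd : HasFDerivAt (fun q : EuclideanSpace ℝ (Fin n) × ℝ =>
      ((2 * Real.pi * inner ℝ ξ q.1 : ℝ) : ℂ) * Complex.I - (q.2 * A : ℝ)) L p := by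
    rw [hLeq]
    exact L.hasFDerivAt
  refine (hd.cexp.mul_const c).congr_fderiv ?_
  rw [hL, smul_smul, mul_jet]
  congr 1
  · funext j
    rw [hc]
    ring
  · rw [hc, pow_succ]
    ring

theorem isJetFamily_mixedKernel (hn : 0 < n) {α : ℝ} (hα : 0 < α) :
    IsJetFamily (n := n) fun i β p => mixedKernel α i β p := by
  simp only [mixedKernel, Real.fourierInv_eq', smul_eq_mul]
  refine isJetFamily_integral (fun i β p hp => ?_) (fun i β p hp => ?_)
    (isJetFamily_exp_mul_mixedSymbol α)
  · refine Continuous.aestronglyMeasurable (Continuous.mul ?_ (continuous_mixedSymbol hα i β _))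
    fun_prop
  · have ht : 0 < p.2 := hp.2
    refine ⟨univ ×ˢ Ioi (p.2 / 2), prod_mem_nhds Filter.univ_mem (lt_mem_nhds (by linarith)), _,
      (integrable_mixedSymbol hn hα i β (half_pos ht)).norm, fun ξ q hq => ?_⟩
    rw [norm_mul, Complex.norm_exp_ofReal_mul_I, one_mul]
    exact norm_mixedSymbol_anti i β (le_of_lt hq.2) ξ

/-- The monomial `ξ ^ β`. -/
noncomputable def monom (β : Fin n → ℕ) (ξ : EuclideanSpace ℝ (Fin n)) : ℝ := ∏ j, ξ j ^ β j

lemma contDiff_monom (β : Fin n → ℕ) : ContDiff ℝ ∞ (monom β) := by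
  unfold monom
  exact contDiff_prod fun j _ => by fun_prop

lemma monom_smul (β : Fin n → ℕ) (R : ℝ) (ξ : EuclideanSpace ℝ (Fin n)) :
    monom β (R • ξ) = R ^ (∑ j, β j) * monom β ξ := by
  simp only [monom, PiLp.smul_apply, smul_eq_mul, mul_pow, Finset.prod_mul_distrib,
    Finset.prod_pow_eq_pow_sum]

lemma mixedSymbol_eq_radialSymbol (α : ℝ) (i : ℕ) (β : Fin n → ℕ) (t : ℝ) (L : ℕ)
    {ξ : EuclideanSpace ℝ (Fin n)} (hξ : ξ ≠ 0) :
    mixedSymbol α i β t ξ =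
      ((-(((2 * Real.pi) ^ α : ℝ) : ℂ)) ^ i * (2 * Real.pi * Complex.I) ^ (∑ j, β j)) *
      radialSymbol (fun ξ => monom β ξ * ‖ξ‖ ^ (2 * L)) (α / 2) (t * (2 * Real.pi) ^ α)
        (i * (α / 2) - L) ξ := by
  have h0 : 0 < ‖ξ‖ := norm_pos_iff.2 hξ
  have hπ : (0 : ℝ) < 2 * Real.pi := by positivity
  have e1 : (2 * Real.pi * ‖ξ‖) ^ α = (2 * Real.pi) ^ α * ‖ξ‖ ^ α := Real.mul_rpow hπ.le h0.le
  have e2 : (‖ξ‖ ^ 2) ^ (α / 2) = ‖ξ‖ ^ α := by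
    rw [← Real.rpow_natCast, ← Real.rpow_mul h0.le]
    congr 1; push_cast; ring
  have e3 : ‖ξ‖ ^ (2 * L) * (‖ξ‖ ^ 2) ^ (i * (α / 2) - L) = (‖ξ‖ ^ α) ^ i := by
    rw [pow_mul, ← Real.rpow_natCast (‖ξ‖ ^ 2) L, ← Real.rpow_add (by positivity), add_sub_cancel,
      mul_comm (i : ℝ), Real.rpow_mul (by positivity), e2, Real.rpow_natCast]
  have e4 : ∏ j, (2 * Real.pi * Complex.I * (ξ j : ℂ)) ^ β j
      = (2 * Real.pi * Complex.I) ^ (∑ j, β j) * (monom β ξ : ℝ) := by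
    simp only [monom, mul_pow (2 * Real.pi * Complex.I : ℂ), Finset.prod_mul_distrib,
      Finset.prod_pow_eq_pow_sum]
    push_cast
    rfl
  have e5 : monom β ξ * ‖ξ‖ ^ (2 * L) * ((‖ξ‖ ^ 2) ^ (i * (α / 2) - L) *
      Real.exp (-(t * (2 * Real.pi) ^ α) * (‖ξ‖ ^ 2) ^ (α / 2)))
      = monom β ξ * (‖ξ‖ ^ α) ^ i * Real.exp (-t * (2 * Real.pi * ‖ξ‖) ^ α) := by
    rw [← e3, e2, e1]
    ring_nf
  rw [mixedSymbol, radialSymbol, e5, e4, heatSymbol, e1]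
  push_cast
  ring

/-- The free parameter `L` transfers `|ξ|^{2L}` from the radial factor to the polynomial: `L = 0`
serves the pointwise decay, `L = nr + 1` the difference estimate. -/
lemma mixedKernel_eq (hn : 0 < n) (α : ℝ) (i : ℕ) (β : Fin n → ℕ) (t : ℝ) (L : ℕ)
    (x : EuclideanSpace ℝ (Fin n)) :
    mixedKernel α i β (x, t) =
      ((-(((2 * Real.pi) ^ α : ℝ) : ℂ)) ^ i * (2 * Real.pi * Complex.I) ^ (∑ j, β j)) *
      𝓕⁻ (radialSymbol (fun ξ => monom β ξ * ‖ξ‖ ^ (2 * L)) (α / 2) (t * (2 * Real.pi) ^ α)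
        (i * (α / 2) - L)) x := by
  have : Nonempty (Fin n) := ⟨⟨0, hn⟩⟩
  have h0 : ∀ᵐ ξ : EuclideanSpace ℝ (Fin n), ξ ≠ 0 := by simp [ae_iff]
  rw [mixedKernel, Real.fourierInv_eq', Real.fourierInv_eq', ← integral_const_mul]
  refine integral_congr_ae ?_
  filter_upwards [h0] with ξ hξ
  simp only [smul_eq_mul]
  rw [mixedSymbol_eq_radialSymbol α i β t L hξ]
  ring

theorem exists_norm_mixedKernel_le (hn : 0 < n) {α : ℝ} (hα : 0 < α) (i : ℕ) (β : Fin n → ℕ)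
    {t₀ t₁ : ℝ} (ht₀ : 0 < t₀) :
    ∃ θ C : ℝ, 0 < θ ∧ 0 ≤ C ∧ ∀ t ∈ Icc t₀ t₁, ∀ x : EuclideanSpace ℝ (Fin n),
      ‖mixedKernel α i β (x, t)‖ ≤ C * (1 + ‖x‖) ^ (-(n + θ)) := by
  have : Nonempty (Fin n) := ⟨⟨0, hn⟩⟩
  have hD : Module.finrank ℝ (EuclideanSpace ℝ (Fin n)) = n := by simp
  have ha : 0 < α / 2 := half_pos hα
  set κ : ℝ := (2 * Real.pi) ^ α with hκ
  have hκ0 : 0 < κ := by positivity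
  set w : ℂ := (-(((2 * Real.pi) ^ α : ℝ) : ℂ)) ^ i * (2 * Real.pi * Complex.I) ^ (∑ j, β j)
    with hw
  -- a positive exponent `e` for the weight, also when there is no time derivative
  obtain ⟨e, A, he, hA, hwt⟩ : ∃ e A : ℝ, 0 < e ∧ 0 ≤ A ∧ ∀ t ∈ Icc t₀ t₁, ∀ v : ℝ, 0 < v →
      |taylorWeight (α / 2) (t * κ) (n + 2) (i * (α / 2) - (0 : ℕ)) v| ≤
        A * (v ^ (e - (n + 2 + 1 : ℕ)) * Real.exp (-((t * κ) / 2) * v ^ (α / 2))) := by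
    rcases Nat.eq_zero_or_pos i with rfl | hi
    · obtain ⟨A, hA, h⟩ := exists_abs_radialDeriv_zero_le ha (n + 2)
      refine ⟨α / 2, |t₁| * κ * A, ha, by positivity, fun t ht v hv => ?_⟩
      have ht0 : 0 < t := ht₀.trans_le ht.1
      refine (abs_taylorWeight_le _ _ _ _ _).trans ?_
      simp only [Nat.cast_zero, zero_mul, sub_zero]
      refine (h (t * κ) v (by positivity) hv).trans ?_
      gcongr
      exact ht.2.trans (le_abs_self t₁)
    · obtain ⟨A, hA, h⟩ := exists_abs_radialDeriv_le ha (n + 2 + 1) (i * (α / 2) - (0 : ℕ))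
      refine ⟨i * (α / 2), A, by positivity, hA, fun t ht v hv => ?_⟩
      have ht0 : 0 < t := ht₀.trans_le ht.1
      refine (abs_taylorWeight_le _ _ _ _ _).trans ?_
      have := h (t * κ) v (by positivity) hv
      simpa only [Nat.cast_zero, sub_zero] using this
  have hp : ContDiff ℝ ∞ (fun ξ => monom β ξ * ‖ξ‖ ^ (2 * 0)) := by
    simpa using contDiff_monom β
  obtain ⟨θ, C, hθ, hC, H⟩ := exists_norm_fourierInv_radialSymbol_le hp (d := ∑ j, β j)
    (fun R hR ξ => by simp [monom_smul]) (c := i * (α / 2) - (0 : ℕ)) ha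
    (show 0 < t₀ * κ by positivity) (show 0 < e + (∑ j, β j : ℕ) / 2 by positivity)
  rw [hD] at H
  refine ⟨θ, ‖w‖ * (A * C), hθ, by positivity, fun t ht x => ?_⟩
  rw [mixedKernel_eq hn α i β t 0 x, ← hw, ← hκ, norm_mul, mul_assoc]
  gcongr
  exact H (t * κ) A (by gcongr; exact ht.1) hA (hwt t ht) x

lemma heatKernel_eq_mixedKernel (α t : ℝ) (x : EuclideanSpace ℝ (Fin n)) :
    heatKernel α t x = mixedKernel α 0 0 (x, t) := by
  rw [heatKernel, mixedKernel, mixedSymbol_zero]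

lemma continuous_mixedKernel (hn : 0 < n) {α : ℝ} (hα : 0 < α) (i : ℕ) (β : Fin n → ℕ) {t : ℝ}
    (ht : 0 < t) : Continuous fun x : EuclideanSpace ℝ (Fin n) => mixedKernel α i β (x, t) :=
  continuous_fourierInv (integrable_mixedSymbol hn hα i β ht)

lemma integrable_mixedKernel (hn : 0 < n) {α : ℝ} (hα : 0 < α) (i : ℕ) (β : Fin n → ℕ) {t : ℝ}
    (ht : 0 < t) : Integrable fun x : EuclideanSpace ℝ (Fin n) => mixedKernel α i β (x, t) := by
  obtain ⟨θ, C, hθ, -, h⟩ := exists_norm_mixedKernel_le hn hα i β (t₁ := t) ht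
  refine integrable_of_norm_le_one_add_norm_rpow (continuous_mixedKernel hn hα i β ht)
    (q := n + θ) ?_ (h t ⟨le_rfl, le_rfl⟩)
  rw [finrank_euclideanSpace, Fintype.card_fin]
  linarith

/-! ### The heat extension of a bounded continuous function -/

/-- The derivative `∂_t^i ∂_x^β` of the fractional heat extension of `f`. -/
noncomputable def mixedHeat (α : ℝ) (f : EuclideanSpace ℝ (Fin n) → ℝ) (i : ℕ) (β : Fin n → ℕ)
    (p : EuclideanSpace ℝ (Fin n) × ℝ) : ℂ :=
  ∫ z, mixedKernel α i β (p.1 - z, p.2) * (f z : ℂ)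

lemma heatSemigroup_eq_mixedHeat (α t : ℝ) (f : EuclideanSpace ℝ (Fin n) → ℝ) :
    heatSemigroup α t f = fun x => mixedHeat α f 0 0 (x, t) := by
  funext x
  simp only [heatSemigroup, mixedHeat, heatKernel_eq_mixedKernel]

theorem isJetFamily_mixedHeat (hn : 0 < n) {α : ℝ} (hα : 0 < α)
    {f : EuclideanSpace ℝ (Fin n) → ℝ} (hf : Continuous f) {F : ℝ} (hF : ∀ x, |f x| ≤ F) :
    IsJetFamily (mixedHeat α f) := by
  have hF0 : 0 ≤ F := (abs_nonneg _).trans (hF 0)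
  refine isJetFamily_integral
    (Φ := fun i β p z => mixedKernel α i β (p.1 - z, p.2) * (f z : ℂ))
    (fun i β p hp => ?_) (fun i β p hp => ?_) (fun z i β p hp => ?_)
  · have h1 := (continuous_mixedKernel hn hα i β hp.2).comp (continuous_sub_left p.1)
    exact (h1.mul (Complex.continuous_ofReal.comp hf)).aestronglyMeasurable
  · have ht : 0 < p.2 := hp.2
    obtain ⟨θ, C, hθ, hC, h⟩ := exists_norm_mixedKernel_le hn hα i β (t₁ := 2 * p.2) (half_pos ht)
    have hq : 0 ≤ n + θ := by positivity
    refine ⟨Metric.ball p.1 1 ×ˢ Ioo (p.2 / 2) (2 * p.2), prod_mem_nhds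
      (Metric.ball_mem_nhds _ one_pos) (Ioo_mem_nhds (by linarith) (by linarith)),
      fun z => C * (2 ^ (n + θ) * (1 + ‖p.1 - z‖) ^ (-(n + θ))) * F, ?_, fun z q hq' => ?_⟩
    · refine Integrable.mul_const (Integrable.const_mul (Integrable.const_mul ?_ _) _) _
      refine Integrable.comp_sub_left
        (f := fun w : EuclideanSpace ℝ (Fin n) => (1 + ‖w‖) ^ (-(n + θ))) ?_ p.1
      refine integrable_one_add_norm ?_
      rw [finrank_euclideanSpace, Fintype.card_fin]
      linarith
    · rw [norm_mul, Complex.norm_real]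
      -- Moving the centre by less than `1` changes `1 + |p.1 - z|` by at most a factor `2`, so one
      -- integrable majorant serves the whole neighbourhood.
      have h1 : ‖p.1 - z‖ ≤ 1 + ‖q.1 - z‖ := by
        have h2 : ‖q.1 - p.1‖ < 1 := by simpa [dist_eq_norm] using hq'.1
        have h3 : p.1 - z = -(q.1 - p.1) + (q.1 - z) := by abel
        rw [h3]
        refine (norm_add_le _ _).trans ?_
        rw [norm_neg]
        linarith
      have h4 : (1 + ‖q.1 - z‖) ^ (-(n + θ)) ≤ 2 ^ (n + θ) * (1 + ‖p.1 - z‖) ^ (-(n + θ)) := by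
        calc (1 + ‖q.1 - z‖) ^ (-(n + θ)) ≤ ((1 + ‖p.1 - z‖) / 2) ^ (-(n + θ)) := by
              refine Real.rpow_le_rpow_of_nonpos (by positivity) ?_ (by linarith)
              have := norm_nonneg (q.1 - z)
              linarith
          _ = _ := by
              rw [Real.div_rpow (by positivity) (by positivity), Real.rpow_neg zero_le_two,
                div_inv_eq_mul, mul_comm]
      refine mul_le_mul ((h q.2 ⟨le_of_lt hq'.2.1, le_of_lt hq'.2.2⟩ _).trans ?_) (hF z)
        (norm_nonneg _) (by positivity)
      gcongr
  · have h1 := isJetFamily_mixedKernel hn hα i β (p.1 - z, p.2) ⟨mem_univ _, hp.2⟩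
    have h2 : (p.1 - z, p.2) = p - (z, (0 : ℝ)) := by ext <;> simp
    rw [h2] at h1
    have h3 := ((hasFDerivAt_comp_sub (z, (0 : ℝ))).2 h1).mul_const (f z : ℂ)
    rw [mul_jet, ← h2] at h3
    refine h3.congr_of_eventuallyEq (Filter.Eventually.of_forall fun q => ?_)
    have h4 : (q.1 - z, q.2) = q - (z, (0 : ℝ)) := by ext <;> simp
    simp only [h4]

/-! ### The multiplier identity -/

lemma fourier_mul_eq_integral {m : EuclideanSpace ℝ (Fin n) → ℂ} (hm : Integrable m)
    (ψ : SchwartzMap (EuclideanSpace ℝ (Fin n)) ℂ) (x : EuclideanSpace ℝ (Fin n)) :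
    𝓕 (fun ξ => m ξ * ψ ξ) x = ∫ z, 𝓕⁻ m (z - x) * 𝓕 (fun ξ => ψ ξ) z := by
  have hψi : Integrable (𝓕 (fun ξ => ψ ξ)) := by
    rw [← SchwartzMap.fourier_coe]
    exact (𝓕 ψ).integrable
  have hinv : ∀ ξ, 𝓕⁻ (𝓕 (fun ξ => ψ ξ)) ξ = ψ ξ := fun ξ =>
    congrFun (Continuous.fourierInv_fourier_eq ψ.continuous ψ.integrable hψi) ξ
  have hprod : Integrable (fun q : EuclideanSpace ℝ (Fin n) × EuclideanSpace ℝ (Fin n) =>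
      Complex.exp (↑(2 * Real.pi * inner ℝ q.2 (q.1 - x)) * Complex.I) *
        (𝓕 (fun ξ => ψ ξ) q.1 * m q.2)) (volume.prod volume) := by
    refine (hψi.mul_prod hm).bdd_mul (c := 1) ?_ (ae_of_all _ fun q => ?_)
    · refine Continuous.aestronglyMeasurable ?_
      fun_prop
    · rw [Complex.norm_exp_ofReal_mul_I]
  calc 𝓕 (fun ξ => m ξ * ψ ξ) x
      = ∫ ξ, ∫ z, Complex.exp (↑(2 * Real.pi * inner ℝ ξ (z - x)) * Complex.I) *
        (𝓕 (fun ξ => ψ ξ) z * m ξ) := by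
        rw [Real.fourier_eq']
        refine integral_congr_ae (ae_of_all _ fun ξ => ?_)
        simp only
        rw [← hinv ξ, Real.fourierInv_eq', smul_eq_mul, ← mul_assoc, ← integral_const_mul]
        refine integral_congr_ae (ae_of_all _ fun z => ?_)
        simp only [smul_eq_mul]
        rw [inner_sub_right, real_inner_comm z ξ, mul_sub, sub_eq_add_neg, Complex.ofReal_add,
          add_mul, Complex.exp_add, neg_mul_eq_neg_mul]
        ring_nf
    _ = ∫ z, ∫ ξ, Complex.exp (↑(2 * Real.pi * inner ℝ ξ (z - x)) * Complex.I) *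
        (𝓕 (fun ξ => ψ ξ) z * m ξ) := (integral_integral_swap hprod).symm
    _ = _ := by
        refine integral_congr_ae (ae_of_all _ fun z => ?_)
        simp only
        rw [Real.fourierInv_eq', ← integral_mul_const]
        refine integral_congr_ae (ae_of_all _ fun ξ => ?_)
        simp only [smul_eq_mul]
        ring

/-- Both sides are iterated integrals of `f(x) 𝓕ψ(z) K(z - x)`, which is integrable on the product
since `𝓕ψ` and `K` are integrable and `f` is bounded. No smoothness of the symbol is used. -/
theorem isMultiplierImage_heatSemigroup (hn : 0 < n) {α : ℝ} (hα : 0 < α) {t : ℝ} (ht : 0 < t)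
    {f : EuclideanSpace ℝ (Fin n) → ℝ} (hf : Continuous f) {F : ℝ} (hF : ∀ x, |f x| ≤ F) :
    IsMultiplierImage (heatSymbol α t) (fun x => (f x : ℂ)) (heatSemigroup α t f) := by
  intro ψ
  have hm : Integrable (heatSymbol (n := n) α t) := by
    rw [← mixedSymbol_zero]
    exact integrable_mixedSymbol hn hα 0 0 ht
  have hK : Integrable (heatKernel (n := n) α t) :=
    (integrable_mixedKernel hn hα 0 0 ht).congr
      (ae_of_all _ fun x => (heatKernel_eq_mixedKernel α t x).symm)
  have hψi : Integrable (𝓕 (fun ξ => ψ ξ)) := by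
    rw [← SchwartzMap.fourier_coe]
    exact (𝓕 ψ).integrable
  have hfc : Continuous (fun x => (f x : ℂ)) := Complex.continuous_ofReal.comp hf
  set G := 𝓕 (fun ξ => ψ ξ) with hG
  have hprod : Integrable (fun q : EuclideanSpace ℝ (Fin n) × EuclideanSpace ℝ (Fin n) =>
      (f q.1 : ℂ) * (G q.2 * heatKernel α t (q.2 - q.1))) (volume.prod volume) := by
    have h := Integrable.convolution_integrand (ContinuousLinearMap.mul ℝ ℂ) hψi hK.comp_neg
      (μ := volume)
    simp only [ContinuousLinearMap.mul_apply', neg_sub] at h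
    exact h.bdd_mul (c := F) (hfc.comp continuous_fst).aestronglyMeasurable
      (ae_of_all _ fun q => by rw [Complex.norm_real]; exact hF q.1)
  have hright : ∀ x, (f x : ℂ) * 𝓕 (fun ξ => heatSymbol α t ξ * ψ ξ) x
      = ∫ z, (f x : ℂ) * (G z * heatKernel α t (z - x)) := fun x => by
    rw [fourier_mul_eq_integral hm, ← integral_const_mul]
    refine integral_congr_ae (ae_of_all _ fun z => ?_)
    simp only [heatKernel]
    ring
  have hleft : ∀ z, heatSemigroup α t f z * G z
      = ∫ x, (f x : ℂ) * (G z * heatKernel α t (z - x)) := fun z => by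
    rw [heatSemigroup, ← integral_mul_const]
    refine integral_congr_ae (ae_of_all _ fun x => ?_)
    ring
  simp only [hright, hleft]
  exact ⟨hprod.integral_prod_right, hprod.integral_prod_left, (integral_integral_swap hprod).symm⟩

/-! ### Consequences of the Lipschitz norm -/

lemma enorm_le_eLpNorm_top {f : EuclideanSpace ℝ (Fin n) → ℝ} (hf : Continuous f)
    (x : EuclideanSpace ℝ (Fin n)) : ‖f x‖ₑ ≤ eLpNorm f ⊤ volume := by
  by_contra! h
  have ho : IsOpen {y | eLpNorm f ⊤ volume < ‖f y‖ₑ} := isOpen_lt continuous_const hf.enorm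
  have h0 : volume {y | eLpNorm f ⊤ volume < ‖f y‖ₑ} = 0 := by
    have := ae_le_eLpNormEssSup (f := f) (μ := volume)
    rw [← eLpNorm_exponent_top, ae_iff] at this
    simpa only [not_le] using this
  exact Set.eq_empty_iff_forall_notMem.1 ((IsOpen.measure_eq_zero_iff volume ho).1 h0) x h

lemma MemLip.abs_le {s : ℝ} {f : EuclideanSpace ℝ (Fin n) → ℝ} (hf : MemLip s f)
    (x : EuclideanSpace ℝ (Fin n)) : |f x| ≤ (lipNorm s f).toReal := by
  have h : ‖f x‖ₑ ≤ lipNorm s f := (enorm_le_eLpNorm_top hf.1 x).trans le_self_add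
  have := ENNReal.toReal_mono hf.2.ne h
  rwa [toReal_enorm, Real.norm_eq_abs] at this

/-- The norm controls only steps `0 < |h| ≤ 1`, whereas the scaling argument uses every step. For
`|h| ≥ 1` the sup norm suffices, since `|h|^s ≥ 1`; this is where `2 ^ r` comes from. -/
lemma MemLip.abs_centralDiff_iterate_le {s : ℝ} (hs : 0 < s)
    {f : EuclideanSpace ℝ (Fin n) → ℝ} (hf : MemLip s f) (h x : EuclideanSpace ℝ (Fin n)) :
    |(centralDiff h)^[⌊s⌋₊ + 1] f x|
      ≤ 2 ^ (⌊s⌋₊ + 1) * (lipNorm s f).toReal * ‖h‖ ^ s := by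
  set N := (lipNorm s f).toReal with hN
  have hN0 : 0 ≤ N := ENNReal.toReal_nonneg
  have htwo : (1 : ℝ) ≤ 2 ^ (⌊s⌋₊ + 1) := one_le_pow₀ one_le_two
  rcases eq_or_ne h 0 with rfl | hne
  · have h0 : centralDiff (0 : EuclideanSpace ℝ (Fin n)) f = fun _ => 0 := by
      funext y; simp [centralDiff]
    have h1 := FracHeat.abs_centralDiff_iterate_le (0 : EuclideanSpace ℝ (Fin n)) ⌊s⌋₊
      (f := fun _ => 0) (F := 0) (by simp) x
    rw [Function.iterate_succ_apply, h0]
    refine h1.trans ?_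
    rw [mul_zero]
    positivity
  have hh : 0 < ‖h‖ := norm_pos_iff.2 hne
  rcases le_total ‖h‖ 1 with h1 | h1
  · have hpos : 0 < ‖h‖ ^ s := by positivity
    have hd : ‖(centralDiff h)^[⌊s⌋₊ + 1] f x‖ₑ / ENNReal.ofReal (‖h‖ ^ s) ≤ lipNorm s f := by
      refine le_trans ?_ (le_add_self (a := _) (b := eLpNorm f ⊤ volume))
      refine le_trans ?_ (le_iSup₂_of_le ‖h‖ ⟨hh, h1⟩ (le_iSup _ x))
      gcongr
      exact le_iSup₂_of_le h rfl le_rfl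
    rw [ENNReal.div_le_iff (by simpa using hpos) ENNReal.ofReal_ne_top] at hd
    have := ENNReal.toReal_mono (ENNReal.mul_ne_top hf.2.ne ENNReal.ofReal_ne_top) hd
    rw [toReal_enorm, Real.norm_eq_abs, ENNReal.toReal_mul, ENNReal.toReal_ofReal hpos.le] at this
    refine this.trans ?_
    gcongr
    exact le_mul_of_one_le_left hN0 htwo
  · refine (FracHeat.abs_centralDiff_iterate_le h _ hf.abs_le x).trans ?_
    exact le_mul_of_one_le_right (by positivity) (Real.one_le_rpow h1 hs.le)

/-! ### The derivative estimate -/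

theorem exists_norm_mixedHeat_le (hn : 0 < n) {α s : ℝ} (hα : 0 < α) (hs : 0 < s) (i : ℕ)
    (β : Fin n → ℕ) (hβ : s < ((∑ j, β j : ℕ) : ℝ) + i * α) :
    ∃ C : ℝ, 0 < C ∧ ∀ f : EuclideanSpace ℝ (Fin n) → ℝ, MemLip s f → ∀ t : ℝ, 0 < t → ∀ x,
      ‖mixedHeat α f i β (x, t)‖ ≤ C * (lipNorm s f).toReal *
        t ^ (-(((∑ j, β j : ℕ) : ℝ) / α + i - s / α)) := by
  have : Nonempty (Fin n) := ⟨⟨0, hn⟩⟩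
  set r := ⌊s⌋₊ + 1 with hr
  set L := n * r + 1 with hL
  set κ : ℝ := (2 * Real.pi) ^ α with hκ
  have hκ0 : 0 < κ := by positivity
  set w : ℂ := (-(((2 * Real.pi) ^ α : ℝ) : ℂ)) ^ i * (2 * Real.pi * Complex.I) ^ (∑ j, β j)
    with hw
  obtain ⟨C, hC, H⟩ := exists_norm_integral_fourierInv_radialSymbol_mul_le (contDiff_monom β) r
    (p := fun ξ => monom β ξ * ‖ξ‖ ^ (2 * L)) (fun ξ => rfl) (d := ∑ j, β j + 2 * L)
    (fun R hR ξ => by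
      simp only [monom_smul, norm_smul, Real.norm_of_nonneg hR.le, mul_pow, pow_add]
      ring)
    (a := α / 2) (c := i * (α / 2) - L) (half_pos hα) hs (by push_cast at hβ ⊢; linarith)
  set E : ℝ := ((∑ j, β j : ℕ) : ℝ) / α + i - s / α with hE
  -- The auxiliary `L` cancels between `2c` and the degree `|β| + 2L`.
  have hexp : -((2 * (i * (α / 2) - L) + (∑ j, β j + 2 * L : ℕ) - s) / (2 * (α / 2))) = -E := by
    rw [hE]
    push_cast
    field_simp
    ring
  rw [hexp] at H
  -- The summand `1` only makes the constant strictly positive.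
  refine ⟨‖w‖ * C * 2 ^ r * κ ^ (-E) + 1, by positivity, fun f hf t ht x => ?_⟩
  have hN0 : 0 ≤ (lipNorm s f).toReal := ENNReal.toReal_nonneg
  have h1 := H (t * κ) f (lipNorm s f).toReal (2 ^ r * (lipNorm s f).toReal) (by positivity) hf.1
    hf.abs_le (hf.abs_centralDiff_iterate_le hs) x
  have h2 : mixedHeat α f i β (x, t) = w * ∫ z, 𝓕⁻ (radialSymbol
      (fun ξ => monom β ξ * ‖ξ‖ ^ (2 * L)) (α / 2) (t * κ) (i * (α / 2) - L)) (x - z) *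
        (f z : ℂ) := by
    rw [mixedHeat, ← integral_const_mul]
    refine integral_congr_ae (ae_of_all _ fun z => ?_)
    simp only
    rw [mixedKernel_eq hn α i β t L (x - z), ← hw, ← hκ, mul_assoc]
  rw [h2, norm_mul]
  calc _ ≤ ‖w‖ * (C * (2 ^ r * (lipNorm s f).toReal) * (t * κ) ^ (-E)) := by gcongr
    _ = (‖w‖ * C * 2 ^ r * κ ^ (-E)) * (lipNorm s f).toReal * t ^ (-E) := by
        rw [Real.mul_rpow ht.le hκ0.le]; ring
    _ ≤ _ := by
        gcongr
        linarith

end FracHeat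

theorem theorem5p8 (n : ℕ) (hn : 0 < n) (α s : ℝ) (hα : 0 < α) (hs : 0 < s)
    (i : ℕ) (β : Fin n → ℕ) (hβ : s < ((∑ j, β j : ℕ) : ℝ) + (i : ℝ) * α) :
    -- for every `f ∈ Λ_s`, the integrals defining `T_{α,t} f` converge,
    (∀ f : EuclideanSpace ℝ (Fin n) → ℝ, FracHeat.MemLip s f →
      (∀ t : ℝ, 0 < t → ∀ x : EuclideanSpace ℝ (Fin n),
        Integrable (fun z => FracHeat.heatKernel α t (x - z) * (f z : ℂ))) ∧
      -- `𝓕 (T_{α,t} f) = exp (-t |2πξ|^α) 𝓕 f`,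
      (∀ t : ℝ, 0 < t →
        FracHeat.IsMultiplierImage (FracHeat.heatSymbol α t) (fun x => (f x : ℂ))
          (FracHeat.heatSemigroup α t f)) ∧
      -- and `u_α` is smooth in `(x, t)`, so that its mixed derivatives are genuine;
      ContDiffOn ℝ ∞
        (fun p : EuclideanSpace ℝ (Fin n) × ℝ => FracHeat.heatSemigroup α p.2 f p.1)
        (univ ×ˢ Ioi (0 : ℝ))) ∧
    -- the derivative bound holds with a constant that does not depend on `f`.
    ∃ C : ℝ, 0 < C ∧ ∀ f : EuclideanSpace ℝ (Fin n) → ℝ, FracHeat.MemLip s f →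
      (⨆ (t : ℝ) (_ : 0 < t),
        ENNReal.ofReal (t ^ (((∑ j, β j : ℕ) : ℝ) / α + (i : ℝ) - s / α)) *
          ⨆ x : EuclideanSpace ℝ (Fin n),
            ‖FracHeat.mixedDeriv i β (fun τ => FracHeat.heatSemigroup α τ f) t x‖ₑ)
        ≤ ENNReal.ofReal C * FracHeat.lipNorm s f := by
  refine ⟨fun f hf => ⟨fun t ht x => ?_, fun t ht => ?_, ?_⟩, ?_⟩
  · simp only [FracHeat.heatKernel_eq_mixedKernel]
    exact FracHeat.integrable_mul_ofReal
      ((FracHeat.integrable_mixedKernel hn hα 0 0 ht).comp_sub_left x) hf.1 hf.abs_le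
  · exact FracHeat.isMultiplierImage_heatSemigroup hn hα ht hf.1 hf.abs_le
  · simp only [FracHeat.heatSemigroup_eq_mixedHeat]
    exact (FracHeat.isJetFamily_mixedHeat hn hα hf.1 hf.abs_le).contDiffOn 0 0
  · obtain ⟨C, hC, H⟩ := FracHeat.exists_norm_mixedHeat_le hn hα hs i β hβ
    refine ⟨C, hC, fun f hf => iSup₂_le fun t ht => ?_⟩
    rw [ENNReal.mul_iSup]
    refine iSup_le fun x => ?_
    rw [(FracHeat.isJetFamily_mixedHeat hn hα hf.1 hf.abs_le).mixedDeriv_eq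
      (fun τ _ => FracHeat.heatSemigroup_eq_mixedHeat α τ f) i β ht x,
      ← ENNReal.ofReal_toReal hf.2.ne, ← ofReal_norm, ← ENNReal.ofReal_mul hC.le,
      ← ENNReal.ofReal_mul (by positivity)]
    refine ENNReal.ofReal_le_ofReal ?_
    calc _ ≤ t ^ (((∑ j, β j : ℕ) : ℝ) / α + (i : ℝ) - s / α) * (C * (FracHeat.lipNorm s f).toReal *
          t ^ (-(((∑ j, β j : ℕ) : ℝ) / α + (i : ℝ) - s / α))) := by
          gcongr
          exact H f hf t ht x
      _ = C * (FracHeat.lipNorm s f).toReal *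
          (t ^ (((∑ j, β j : ℕ) : ℝ) / α + (i : ℝ) - s / α) *
          t ^ (-(((∑ j, β j : ℕ) : ℝ) / α + (i : ℝ) - s / α))) := by ring
      _ = _ := by rw [← Real.rpow_add ht, add_neg_cancel, Real.rpow_zero, mul_one]
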